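/- Let $X$ be a simplicial graph (undirected, without loops or multiple edges, possibly infinite and not necessarily locally finite). Write $d$ for the graph-metric. The graph $X$ is called \emph{median} if it is (non-empty and) connected and, for any three vertices $x_1,x_2,x_3$, there exists a unique vertex $m$ such that $d(x_i,x_j)=d(x_i,m)+d(m,x_j)$ for all distinct $i,j\in\{1,2,3\}$. A \emph{4-cycle} of $X$ is a subgraph (not necessarily induced) with four distinct vertices and four edges which is a cycle. The \emph{square-completion} of $X$ is the square complex obtained from $X$, seen as a one-dimensional complex, by gluing one square $[0,1]^2$ along its boundary to each 4-cycle of $X$. \textbf{Theorem.} Let $X$ be a simplicial graph. Then $X$ is median if and only if the following three conditions hold: \begin{itemize} \item the square-completion of $X$ is simply connected (in particular non-empty and path-connected); \item for every vertex $v$ of $X$ and all neighbours $a,b$ of $v$, the edges $[v,a],[v,b]$ span at most one 4-cycle, i.e.\ there is at most one vertex $w$ such that $v,a,w,b$ are the consecutive vertices of a 4-cycle of $X$; \item for every vertex $v$ of $X$ and all neighbours $a,b,c$ of $v$, if any two of the three edges $[v,a],[v,b],[v,c]$ span a 4-cycle, then the three edges span the one-skeleton of a 3-cube, i.e.\ $X$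 contains a subgraph isomorphic to the product of three edges in which $[v,a],[v,b],[v,c]$ are the three edges at the vertex $v$. \end{itemize} -/

import Mathlib

namespace SimpleGraph

open scoped unitInterval

universe u

variable {V : Type u}

/-- The vertex `m` is a median point of `x`, `y`, `z`: it lies on a geodesic between each two of
these three vertices. -/
def IsMedianPoint (G : SimpleGraph V) (x y z m : V) : Prop :=
  G.dist x y = G.dist x m + G.dist m y ∧
  G.dist y z = G.dist y m + G.dist m z ∧
  G.dist z x = G.dist z m + G.dist m x

/-- A graph is median if it is connected (so that distances are genuine) and any three vertices
have exactly one median point. -/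
def IsMedian (G : SimpleGraph V) : Prop :=
  G.Connected ∧ ∀ x y z : V, ∃! m : V, G.IsMedianPoint x y z m

/-- A `4`-cycle of `G` with a chosen starting vertex and direction: four distinct vertices
`a, b, c, d` which are consecutively adjacent in cyclic order. (Adjacent vertices are distinct.)
Every subgraph which is a `4`-cycle arises from exactly eight terms of this type. -/
@[ext]
structure FourCycle (G : SimpleGraph V) where
  a : V
  b : V
  c : V
  d : V
  adj_ab : G.Adj a b
  adj_bc : G.Adj b c
  adj_cd : G.Adj c d
  adj_da : G.Adj d a
  a_ne_c : a ≠ c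
  b_ne_d : b ≠ d

namespace FourCycle

variable {G : SimpleGraph V}

/-- The same `4`-cycle, started at the next vertex. -/
def rotate (q : FourCycle G) : FourCycle G :=
  ⟨q.b, q.c, q.d, q.a, q.adj_bc, q.adj_cd, q.adj_da, q.adj_ab, q.b_ne_d, q.a_ne_c.symm⟩

/-- The same `4`-cycle, run through in the opposite direction from the same vertex. -/
def reflect (q : FourCycle G) : FourCycle G :=
  ⟨q.a, q.d, q.c, q.b, q.adj_da.symm, q.adj_cd.symm, q.adj_bc.symm, q.adj_ab.symm,
    q.a_ne_c, q.b_ne_d.symm⟩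

/-- The first oriented edge `a → b` of the `4`-cycle. -/
def firstDart (q : FourCycle G) : G.Dart := ⟨(q.a, q.b), q.adj_ab⟩

end FourCycle

/-- The disjoint union (with its usual topology) of one point for each vertex, one unit interval for
each oriented edge and one unit square for each parametrized `4`-cycle of `G`. -/
abbrev Cells (G : SimpleGraph V) : Type u :=
  (Σ _ : V, Unit) ⊕ (Σ _ : G.Dart, I) ⊕ (Σ _ : FourCycle G, I × I)

namespace Cells

variable {G : SimpleGraph V}

/-- The point belonging to a vertex. -/
def vertexPoint (v : V) : Cells G := Sum.inl ⟨v, ()⟩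

/-- The point with parameter `t` of the interval belonging to the oriented edge `e`. It is meant to
run from the source of `e` at `t = 0` to its target at `t = 1`. -/
def edgePoint (e : G.Dart) (t : I) : Cells G := Sum.inr (Sum.inl ⟨e, t⟩)

/-- The point `(s, t)` of the unit square belonging to `q`, whose corners `(0, 0)`, `(1, 0)`,
`(1, 1)`, `(0, 1)` are meant to be the vertices `q.a`, `q.b`, `q.c`, `q.d`. -/
def squarePoint (q : FourCycle G) (s t : I) : Cells G := Sum.inr (Sum.inr ⟨q, (s, t)⟩)

/-- The gluing relations: the two orientations of an edge give the same interval, the eight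
parametrizations of a `4`-cycle give the same square, intervals are glued to their end points and
squares are glued along their four sides. The relations at the remaining end point and along the
remaining three sides follow by symmetry from the ones that are listed. -/
inductive Glue : Cells G → Cells G → Prop
  | edge_source (e : G.Dart) : Glue (edgePoint e 0) (vertexPoint e.fst)
  | edge_symm (e : G.Dart) (t : I) : Glue (edgePoint e t) (edgePoint e.symm (unitInterval.symm t))
  | square_side (q : FourCycle G) (s : I) : Glue (squarePoint q s 0) (edgePoint q.firstDart s)
  | square_rotate (q : FourCycle G) (s t : I) :
      Glue (squarePoint q s t) (squarePoint q.rotate t (unitInterval.symm s))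
  | square_reflect (q : FourCycle G) (s t : I) : Glue (squarePoint q s t) (squarePoint q.reflect t s)

end Cells

/-- The square-completion of `G`: the square complex obtained from `G`, seen as a one-dimensional
complex, by filling in every `4`-cycle with one square, with the quotient topology. -/
def SquareCompletion (G : SimpleGraph V) : Type u :=
  Quot (Cells.Glue (G := G))

instance (G : SimpleGraph V) : TopologicalSpace (SquareCompletion G) :=
  inferInstanceAs (TopologicalSpace (Quot (Cells.Glue (G := G))))

/-- `v, a, w, b` are the consecutive vertices of a `4`-cycle: the edges `[v, a]` and `[v, b]` span a
`4`-cycle whose fourth vertex is `w`. -/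
def SpanFourCycleWith (G : SimpleGraph V) (v a b w : V) : Prop :=
  ∃ q : FourCycle G, q.a = v ∧ q.b = a ∧ q.c = w ∧ q.d = b

/-- The edges `[v, a]` and `[v, b]` span a `4`-cycle. -/
def SpanFourCycle (G : SimpleGraph V) (v a b : V) : Prop :=
  ∃ w : V, G.SpanFourCycleWith v a b w

/-- The one-skeleton of the `3`-cube: the Cartesian product of three edges. -/
def cubeGraph : SimpleGraph (Fin 2 × Fin 2 × Fin 2) :=
  completeGraph (Fin 2) □ (completeGraph (Fin 2) □ completeGraph (Fin 2))

/-- The edges `[v, a]`, `[v, b]`, `[v, c]` span the one-skeleton of a `3`-cube: `G` has a subgraph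
isomorphic to `cubeGraph` in which `v` is a corner and these are the three edges at `v`. -/
def SpanCube (G : SimpleGraph V) (v a b c : V) : Prop :=
  ∃ f : Copy cubeGraph G,
    f (0, 0, 0) = v ∧ f (1, 0, 0) = a ∧ f (0, 1, 0) = b ∧ f (0, 0, 1) = c

end SimpleGraph

/-!
# Median graphs and their square-completions

Both directions pass through the *quadrangle condition* for all base vertices `v`: two neighbours
of `z` that are closer to `v` than `z` have a common neighbour that is closer still.

A connected bipartite graph with the quadrangle condition in which two edges at a vertex span at
most one `4`-cycle is median (`QuadrangleCondition.isMedian`): one of three vertices can always be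
moved towards the other two (`QuadrangleCondition.exists_closer`), which gives existence of
medians by induction, and two different first steps towards two medians close up to one square,
which gives uniqueness.

*From the local conditions to medians.* Fix a vertex `v`. Paths starting at `v` are considered up
to swaps across `4`-cycles (`SwapEquiv`), as words are in a right-angled Coxeter group. The cube
condition implies that two equivalent paths which arrive at `z` through different neighbours can
be swapped at `z` in a single step (this is transitivity in `SwapEquiv.trans_aux`). Hence each
edge from `z` to `z'` acts on the classes of reduced paths from `v` to `z`, by prolonging a path
or by undoing its last step; the two orientations of the edge act inversely to each other, and
both ways around a `4`-cycle act alike (`Sq.stepTo_stepTo`). These actions form a local system of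
sets on the graph. Local systems extend to coverings of the square-completion, which are trivial
over a simply connected base (`SquareCompletion.localSystemsTrivial`). A section through the
constant path assigns to every vertex one class of reduced paths from `v`, compatibly with all
edges. The lengths of these paths are the distances to `v`, and the one-step swaps at their ends
are the quadrangle condition (`LocalSystemsTrivial.quadrangleCondition`).

*From medians to the local conditions.* Uniqueness of squares and the cube condition are
statements about medians of vertices at pairwise distance two. For simple connectivity, the
quadrangle condition shows that all geodesics from a vertex `z` to a base vertex have one homotopy
class (`SquareCompletion.walkClass_eq_of_geodesic`), and that these classes are compatible with
the edges. They extend to a family of path classes at all points which is compatible with paths in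
open stars of vertices, because such stars are contractible and cells are simply connected. By
subdivision the family is compatible with all paths, so any two paths with the same end points are
homotopic (`SimplyConnectedSpace.of_open_cover`).
-/

open scoped unitInterval
open Topology

universe u

namespace SimpleGraph

variable {V : Type u} {G : SimpleGraph V}

/-! ### Graph conditions and `4`-cycles -/

/-- Adjacent vertices never have the same distance to a third vertex; for connected graphs this says
that the graph is bipartite. -/
def DistParity (G : SimpleGraph V) : Prop :=
  ∀ v x y : V, G.Adj x y → G.dist x v ≠ G.dist y v

/-- The quadrangle condition: two neighbours of `z` which are closer to `v` than `z` have a common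
neighbour which is closer to `v` by one more step. -/
def QuadrangleCondition (G : SimpleGraph V) : Prop :=
  ∀ v z x y : V, G.Adj z x → G.Adj z y → x ≠ y →
    G.dist z v = G.dist x v + 1 → G.dist z v = G.dist y v + 1 →
      ∃ u, G.Adj x u ∧ G.Adj y u ∧ G.dist z v = G.dist u v + 2

/-- Two edges at a vertex span at most one `4`-cycle. -/
def UniqueSquares (G : SimpleGraph V) : Prop :=
  ∀ v a b : V, G.Adj v a → G.Adj v b →
    ∀ w w' : V, G.SpanFourCycleWith v a b w → G.SpanFourCycleWith v a b w' → w = w'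

/-- Three edges at a vertex which pairwise span `4`-cycles span a `3`-cube. -/
def CubeCondition (G : SimpleGraph V) : Prop :=
  ∀ v a b c : V, G.Adj v a → G.Adj v b → G.Adj v c →
    G.SpanFourCycle v a b → G.SpanFourCycle v b c → G.SpanFourCycle v a c → G.SpanCube v a b c

/-- `x, a, u, b` are the consecutive vertices of a `4`-cycle. -/
structure Sq (G : SimpleGraph V) (x a u b : V) : Prop where
  xa : G.Adj x a
  au : G.Adj a u
  xb : G.Adj x b
  bu : G.Adj b u
  xu : x ≠ u
  ab : a ≠ b

lemma spanFourCycleWith_iff {x a b u : V} : G.SpanFourCycleWith x a b u ↔ Sq G x a u b := by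
  constructor
  · rintro ⟨q, rfl, rfl, rfl, rfl⟩
    exact ⟨q.adj_ab, q.adj_bc, q.adj_da.symm, q.adj_cd.symm, q.a_ne_c, q.b_ne_d⟩
  · intro h
    exact ⟨⟨x, a, u, b, h.xa, h.au, h.bu.symm, h.xb.symm, h.xu, h.ab⟩, rfl, rfl, rfl, rfl⟩

namespace Sq
variable {x a u b : V}

lemma reflect (h : Sq G x a u b) : Sq G x b u a := ⟨h.xb, h.bu, h.xa, h.au, h.xu, h.ab.symm⟩

lemma rotate (h : Sq G x a u b) : Sq G a u b x :=
  ⟨h.au, h.bu.symm, h.xa.symm, h.xb, h.ab, h.xu.symm⟩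

lemma unique (hG : UniqueSquares G) {u' : V} (h : Sq G x a u b) (h' : Sq G x a u' b) : u = u' :=
  hG x a b h.xa h.xb u u' (spanFourCycleWith_iff.2 h) (spanFourCycleWith_iff.2 h')

end Sq

lemma DistParity.eq_or_eq (hp : DistParity G) (hc : G.Connected) {x y : V} (h : G.Adj x y) (v : V) :
    G.dist x v = G.dist y v + 1 ∨ G.dist y v = G.dist x v + 1 := by
  have h1 := hc.dist_triangle (u := x) (v := y) (w := v)
  have h2 := hc.dist_triangle (u := y) (v := x) (w := v)
  have h3 := dist_eq_one_iff_adj.2 h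
  have h4 := dist_eq_one_iff_adj.2 h.symm
  have := hp v x y h
  omega

lemma Connected.exists_adj_dist_eq (hc : G.Connected) {x y : V} (h : x ≠ y) :
    ∃ x', G.Adj x x' ∧ G.dist x y = G.dist x' y + 1 := by
  obtain ⟨p, hp⟩ := hc.exists_walk_length_eq_dist x y
  cases p with
  | nil => exact absurd rfl h
  | @cons _ x' _ hx q =>
    refine ⟨x', hx, ?_⟩
    have h1 := dist_le q
    have h2 := hc.dist_triangle (u := x) (v := x') (w := y)
    have h3 := dist_eq_one_iff_adj.2 hx
    simp only [Walk.length_cons] at hp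
    omega

/-! ### From the quadrangle condition to medians -/

/-- The quadrangle condition lets one shorten one of the sides at `x`, `y` of a nondegenerate
triangle `x, y, z`: some neighbour of `x` is closer to both `y` and `z`, or some neighbour of `y` is
closer to both `x` and `z`. -/
lemma QuadrangleCondition.exists_closer (hq : QuadrangleCondition G) (hp : DistParity G)
    (hc : G.Connected) (z : V) : ∀ (n : ℕ) (x y : V), G.dist x y = n → x ≠ y →
    (∃ x', G.Adj x x' ∧ G.dist x y = G.dist x' y + 1 ∧ G.dist x z = G.dist x' z + 1) ∨
    (∃ y', G.Adj y y' ∧ G.dist y x = G.dist y' x + 1 ∧ G.dist y z = G.dist y' z + 1) := by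
  intro n
  induction n with
  | zero =>
    intro x y h hxy
    exact absurd (hc.dist_eq_zero_iff.1 h) hxy
  | succ n ih =>
    intro x y h hxy
    obtain ⟨x', hx, hx'⟩ := hc.exists_adj_dist_eq hxy
    rcases hp.eq_or_eq hc hx z with hz | hz
    · exact Or.inl ⟨x', hx, hx', hz⟩
    by_cases hy : x' = y
    · subst hy
      exact Or.inr ⟨x, hx.symm, by rw [dist_comm, hx', dist_self, dist_self], hz⟩
    rcases ih x' y (by omega) hy with ⟨w, hw, hwy, hwz⟩ | ⟨w, hw, hwx, hwz⟩
    · have hxw : x ≠ w := by rintro rfl; omega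
      obtain ⟨u, hxu, hwu, hu⟩ := hq z x' x w hx.symm hw hxw hz hwz
      refine Or.inl ⟨u, hxu, ?_, by omega⟩
      have h1 := hc.dist_triangle (u := u) (v := w) (w := y)
      have h2 := hc.dist_triangle (u := x) (v := u) (w := y)
      have h3 := dist_eq_one_iff_adj.2 hwu.symm
      have h4 := dist_eq_one_iff_adj.2 hxu
      omega
    · refine Or.inr ⟨w, hw, ?_, hwz⟩
      have h1 := hc.dist_triangle (u := w) (v := x') (w := x)
      have h2 := hc.dist_triangle (u := y) (v := w) (w := x)
      have h3 := dist_eq_one_iff_adj.2 hx.symm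
      have h4 := dist_eq_one_iff_adj.2 hw
      have h5 : G.dist y x = G.dist x y := dist_comm
      have h6 : G.dist y x' = G.dist x' y := dist_comm
      omega

lemma IsMedianPoint.swap {x y z m : V} (h : G.IsMedianPoint x y z m) :
    G.IsMedianPoint y x z m := by
  obtain ⟨h1, h2, h3⟩ := h
  have e1 : G.dist y x = G.dist x y := dist_comm
  have e2 : G.dist x z = G.dist z x := dist_comm
  have e3 : G.dist z y = G.dist y z := dist_comm
  have e4 : G.dist m x = G.dist x m := dist_comm
  have e5 : G.dist m y = G.dist y m := dist_comm
  have e6 : G.dist m z = G.dist z m := dist_comm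
  exact ⟨by omega, by omega, by omega⟩

/-- A median point for a triple stays one when the first vertex is moved away from the other
two. -/
lemma IsMedianPoint.of_closer (hc : G.Connected) {x x' y z m : V} (hx : G.Adj x x')
    (hy : G.dist x y = G.dist x' y + 1) (hz : G.dist x z = G.dist x' z + 1)
    (h : G.IsMedianPoint x' y z m) : G.IsMedianPoint x y z m := by
  obtain ⟨h1, h2, h3⟩ := h
  have h4 := dist_eq_one_iff_adj.2 hx
  have h5 := hc.dist_triangle (u := x) (v := x') (w := m)
  have h6 := hc.dist_triangle (u := x) (v := m) (w := y)
  have e1 : G.dist z x = G.dist x z := dist_comm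
  have e2 : G.dist z x' = G.dist x' z := dist_comm
  have e3 : G.dist m x = G.dist x m := dist_comm
  have e4 : G.dist m x' = G.dist x' m := dist_comm
  exact ⟨by omega, h2, by omega⟩

/-- A median point for a triple stays one when the first vertex is moved towards it. -/
lemma IsMedianPoint.to_closer (hc : G.Connected) {x x' y z m : V} (hx : G.Adj x x')
    (hm : G.dist x m = G.dist x' m + 1) (h : G.IsMedianPoint x y z m) :
    G.IsMedianPoint x' y z m ∧ G.dist x y = G.dist x' y + 1 ∧ G.dist x z = G.dist x' z + 1 := by
  obtain ⟨h1, h2, h3⟩ := h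
  have h4 := dist_eq_one_iff_adj.2 hx
  have h5 := hc.dist_triangle (u := x') (v := m) (w := y)
  have h6 := hc.dist_triangle (u := x) (v := x') (w := y)
  have h7 := hc.dist_triangle (u := x') (v := m) (w := z)
  have h8 := hc.dist_triangle (u := x) (v := x') (w := z)
  have e1 : G.dist z x = G.dist x z := dist_comm
  have e2 : G.dist z x' = G.dist x' z := dist_comm
  have e3 : G.dist m x = G.dist x m := dist_comm
  have e4 : G.dist m x' = G.dist x' m := dist_comm
  have e5 : G.dist z m = G.dist m z := dist_comm
  exact ⟨⟨by omega, h2, by omega⟩, by omega, by omega⟩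

lemma QuadrangleCondition.exists_isMedianPoint (hq : QuadrangleCondition G) (hp : DistParity G)
    (hc : G.Connected) : ∀ (n : ℕ) (x y z : V), G.dist x y ≤ n →
      ∃ m, G.IsMedianPoint x y z m := by
  intro n
  induction n with
  | zero =>
    intro x y z h
    obtain rfl := hc.dist_eq_zero_iff.1 (Nat.le_zero.1 h)
    exact ⟨x, by simp [IsMedianPoint]⟩
  | succ n ih =>
    intro x y z h
    by_cases hxy : x = y
    · subst hxy
      exact ⟨x, by simp [IsMedianPoint]⟩
    rcases hq.exists_closer hp hc z _ x y rfl hxy with ⟨w, hw, h1, h2⟩ | ⟨w, hw, h1, h2⟩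
    · obtain ⟨m, hm⟩ := ih w y z (by omega)
      exact ⟨m, hm.of_closer hc hw h1 h2⟩
    · rw [dist_comm] at h
      obtain ⟨m, hm⟩ := ih w x z (by omega)
      exact ⟨m, (hm.of_closer hc hw h1 h2).swap⟩

/-- Uniqueness of median points. Given two of them for `x, y, z`, step from `x` towards each; if the
two steps differ, they span a square whose tip is again closer to `y` and `z`, and a median point
for the tip is a median point for both of the nearer triples. -/
lemma QuadrangleCondition.isMedianPoint_unique (hq : QuadrangleCondition G) (hp : DistParity G)
    (hu : UniqueSquares G) (hc : G.Connected) : ∀ (n : ℕ) (x y z m m' : V), G.dist x y ≤ n →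
      G.IsMedianPoint x y z m → G.IsMedianPoint x y z m' → m = m' := by
  have base : ∀ x y z m : V, G.IsMedianPoint x y z x → G.IsMedianPoint x y z m → x = m := by
    rintro x y z m ⟨-, h2, -⟩ ⟨h1, h2', h3⟩
    have e1 : G.dist m x = G.dist x m := dist_comm
    have e2 : G.dist y x = G.dist x y := dist_comm
    have e3 : G.dist m y = G.dist y m := dist_comm
    have e4 : G.dist z x = G.dist x z := dist_comm
    have e5 : G.dist m z = G.dist z m := dist_comm
    exact hc.dist_eq_zero_iff.1 (by omega)
  intro n
  induction n with
  | zero =>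
    intro x y z m m' h hm hm'
    have h1 := hm.1
    have h2 := hm'.1
    have e1 := hc.dist_eq_zero_iff.1 (show G.dist x m = 0 by omega)
    have e2 := hc.dist_eq_zero_iff.1 (show G.dist x m' = 0 by omega)
    rw [← e1, ← e2]
  | succ n ih =>
    intro x y z m m' h hm hm'
    by_cases hxm : x = m
    · subst hxm; exact base _ _ _ _ hm hm'
    by_cases hxm' : x = m'
    · subst hxm'; exact (base _ _ _ _ hm' hm).symm
    obtain ⟨a, ha, ham⟩ := hc.exists_adj_dist_eq hxm
    obtain ⟨b, hb, hbm⟩ := hc.exists_adj_dist_eq hxm'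
    obtain ⟨hma, hay, haz⟩ := hm.to_closer hc ha ham
    obtain ⟨hmb, hby, hbz⟩ := hm'.to_closer hc hb hbm
    -- `a` and `b` are the first steps from `x` towards `m` and `m'`.
    by_cases hab : a = b
    · subst hab
      exact ih a y z m m' (by omega) hma hmb
    obtain ⟨t, hat, hbt, ht⟩ := hq y x a b ha hb hab hay hby
    obtain ⟨t', hat', hbt', ht'⟩ := hq z x a b ha hb hab haz hbz
    have htt : t = t' := Sq.unique hu (x := x) (a := a) (b := b)
      ⟨ha, hat, hb, hbt, by rintro rfl; omega, hab⟩ ⟨ha, hat', hb, hbt', by rintro rfl; omega, hab⟩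
    subst htt
    obtain ⟨k, hk⟩ := hq.exists_isMedianPoint hp hc _ t y z le_rfl
    have h1 := ih a y z m k (by omega) hma (hk.of_closer hc hat (by omega) (by omega))
    have h2 := ih b y z m' k (by omega) hmb (hk.of_closer hc hbt (by omega) (by omega))
    rw [h1, h2]

theorem QuadrangleCondition.isMedian (hq : QuadrangleCondition G) (hp : DistParity G)
    (hu : UniqueSquares G) (hc : G.Connected) : G.IsMedian := by
  refine ⟨hc, fun x y z => ?_⟩
  obtain ⟨m, hm⟩ := hq.exists_isMedianPoint hp hc _ x y z le_rfl
  exact ⟨m, hm, fun m' hm' => hq.isMedianPoint_unique hp hu hc _ x y z m' m le_rfl hm' hm⟩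

/-! ### Local structure of median graphs -/

namespace IsMedian

lemma distParity (h : G.IsMedian) : DistParity G := by
  intro v x y hxy he
  obtain ⟨m, ⟨h1, h2, h3⟩, -⟩ := h.2 x y v
  have h4 := dist_eq_one_iff_adj.2 hxy
  have e1 : G.dist m y = G.dist y m := dist_comm
  have e2 : G.dist m x = G.dist x m := dist_comm
  have e3 : G.dist v x = G.dist x v := dist_comm
  have e4 : G.dist v m = G.dist m v := dist_comm
  omega

/-- In a median graph two distinct neighbours of a vertex are at distance two. -/
lemma dist_eq_two (h : G.IsMedian) {x y z : V} (hx : G.Adj z x) (hy : G.Adj z y) (hxy : x ≠ y) :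
    G.dist x y = 2 := by
  have h1 := h.1.dist_triangle (u := x) (v := z) (w := y)
  have h2 := dist_eq_one_iff_adj.2 hx.symm
  have h3 := dist_eq_one_iff_adj.2 hy
  rcases h.distParity.eq_or_eq h.1 hx y with h4 | h4
  · exact absurd (h.1.dist_eq_zero_iff.1 (by omega)) hxy
  · omega

lemma quadrangleCondition (h : G.IsMedian) : QuadrangleCondition G := by
  intro v z x y hx hy hxy h1 h2
  obtain ⟨m, ⟨m1, m2, m3⟩, -⟩ := h.2 x y v
  have h3 := h.dist_eq_two hx hy hxy
  have e1 : G.dist m y = G.dist y m := dist_comm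
  have e2 : G.dist m x = G.dist x m := dist_comm
  have e3 : G.dist v x = G.dist x v := dist_comm
  have e4 : G.dist v m = G.dist m v := dist_comm
  exact ⟨m, dist_eq_one_iff_adj.1 (by omega), dist_eq_one_iff_adj.1 (by omega), by omega⟩

/-- A vertex adjacent to three vertices at pairwise distance two is a median point for them. -/
lemma isMedianPoint_of_adj (h : G.IsMedian) {x y z m : V} (hx : G.Adj m x) (hy : G.Adj m y)
    (hz : G.Adj m z) (hxy : x ≠ y) (hyz : y ≠ z) (hzx : z ≠ x) : G.IsMedianPoint x y z m := by
  refine ⟨?_, ?_, ?_⟩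
  · rw [h.dist_eq_two hx hy hxy, dist_eq_one_iff_adj.2 hx.symm, dist_eq_one_iff_adj.2 hy]
  · rw [h.dist_eq_two hy hz hyz, dist_eq_one_iff_adj.2 hy.symm, dist_eq_one_iff_adj.2 hz]
  · rw [h.dist_eq_two hz hx hzx, dist_eq_one_iff_adj.2 hz.symm, dist_eq_one_iff_adj.2 hx]

/-- A median graph contains no complete bipartite graph `K_{2,3}`. -/
lemma eq_of_three_common_neighbors (h : G.IsMedian) {x y z m m' : V} (hx : G.Adj m x)
    (hy : G.Adj m y) (hz : G.Adj m z) (hx' : G.Adj m' x) (hy' : G.Adj m' y) (hz' : G.Adj m' z)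
    (hxy : x ≠ y) (hyz : y ≠ z) (hzx : z ≠ x) : m = m' :=
  (h.2 x y z).unique (h.isMedianPoint_of_adj hx hy hz hxy hyz hzx)
    (h.isMedianPoint_of_adj hx' hy' hz' hxy hyz hzx)

lemma uniqueSquares (h : G.IsMedian) : UniqueSquares G := by
  intro v a b ha hb w w' hw hw'
  rw [spanFourCycleWith_iff] at hw hw'
  by_contra hne
  exact hw.ab (h.eq_of_three_common_neighbors ha.symm hw.au hw'.au hb.symm hw.bu hw'.bu
    hw.xu hne hw'.xu.symm)

end IsMedian

/-- To span a cube it suffices to have the eight vertices and the twelve edges, with the vertices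
distinct. -/
lemma spanCube_of {v a b c ab bc ac w : V} (ha : G.Adj v a) (hb : G.Adj v b) (hc : G.Adj v c)
    (h1 : G.Adj a ab) (h2 : G.Adj b ab) (h3 : G.Adj b bc) (h4 : G.Adj c bc) (h5 : G.Adj a ac)
    (h6 : G.Adj c ac) (h7 : G.Adj ab w) (h8 : G.Adj bc w) (h9 : G.Adj ac w)
    (hd : [v, c, b, bc, a, ac, ab, w].Nodup) : G.SpanCube v a b c := by
  let idx : Fin 2 × Fin 2 × Fin 2 → Fin 8 :=
    fun p => ⟨4 * p.1.1 + 2 * p.2.1.1 + p.2.2.1, by omega⟩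
  have hidx : Function.Injective idx := by decide
  let f : Fin 2 × Fin 2 × Fin 2 → V := fun p => [v, c, b, bc, a, ac, ab, w].get (idx p)
  refine ⟨⟨⟨f, ?_⟩, (List.nodup_iff_injective_get.1 hd).comp hidx⟩, rfl, rfl, rfl, rfl⟩
  rintro ⟨i, j, k⟩ ⟨i', j', k'⟩ h
  fin_cases i <;> fin_cases j <;> fin_cases k <;> fin_cases i' <;> fin_cases j' <;>
    fin_cases k' <;> simp [cubeGraph, boxProd_adj, f, idx] at h ⊢ <;>
    first | assumption | (apply Adj.symm; assumption)

/-- The vertices of a cube other than the corner `v` and its neighbours. -/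
lemma SpanCube.exists_tips {v a b c : V} (h : G.SpanCube v a b c) :
    ∃ ab bc ac w, Sq G v a ab b ∧ Sq G v b bc c ∧ Sq G v a ac c ∧
      Sq G a ab w ac ∧ Sq G b ab w bc ∧ Sq G c bc w ac := by
  obtain ⟨f, rfl, rfl, rfl, rfl⟩ := h
  have hadj : ∀ {p q : Fin 2 × Fin 2 × Fin 2}, cubeGraph.Adj p q → G.Adj (f p) (f q) :=
    fun {p q} h => f.toHom.map_adj h
  have hne : ∀ {p q : Fin 2 × Fin 2 × Fin 2}, p ≠ q → f p ≠ f q :=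
    fun {p q} h e => h (f.injective e)
  refine ⟨f (1, 1, 0), f (0, 1, 1), f (1, 0, 1), f (1, 1, 1), ?_, ?_, ?_, ?_, ?_, ?_⟩ <;>
    constructor <;> first
      | (apply hadj; simp [cubeGraph, boxProd_adj])
      | (apply hne; simp)

lemma IsMedian.cubeCondition (h : G.IsMedian) : CubeCondition G := by
  rintro v a b c ha hb hc ⟨x, hx⟩ ⟨y, hy⟩ ⟨z, hz⟩
  rw [spanFourCycleWith_iff] at hx hy hz
  have hab := hx.ab
  have hbc := hy.ab
  have hac := hz.ab
  have nadj : ∀ {p q r : V}, G.Adj r p → G.Adj r q → ¬ G.Adj p q := by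
    intro p q r hp hq hpq
    have := h.dist_eq_two hp hq hpq.ne
    rw [dist_eq_one_iff_adj.2 hpq] at this
    omega
  -- If two of the three tips agreed, `v` and the tip would have three common neighbours.
  have nay : ¬ G.Adj a y := fun e => hy.xu
    (h.eq_of_three_common_neighbors ha hb hc e.symm hy.au.symm hy.bu.symm hab hbc hac.symm)
  have nbz : ¬ G.Adj b z := fun e => hz.xu
    (h.eq_of_three_common_neighbors ha hb hc hz.au.symm e.symm hz.bu.symm hab hbc hac.symm)
  have ncx : ¬ G.Adj c x := fun e => hx.xu
    (h.eq_of_three_common_neighbors ha hb hc hx.au.symm hx.bu.symm e.symm hab hbc hac.symm)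
  have hxy : x ≠ y := by rintro rfl; exact nay hx.au
  have hyz : y ≠ z := by rintro rfl; exact nay hz.au
  have hzx : z ≠ x := by rintro rfl; exact ncx hz.bu
  obtain ⟨m, ⟨m1, m2, m3⟩, -⟩ := h.2 x y z
  have d1 := h.dist_eq_two hx.bu hy.au hxy
  have d2 := h.dist_eq_two hy.bu hz.bu hyz
  have d3 := h.dist_eq_two hz.au hx.au hzx
  have e1 : G.dist m y = G.dist y m := dist_comm
  have e2 : G.dist m x = G.dist x m := dist_comm
  have e3 : G.dist m z = G.dist z m := dist_comm
  have hxm : G.Adj x m := dist_eq_one_iff_adj.1 (by omega)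
  have hym : G.Adj y m := dist_eq_one_iff_adj.1 (by omega)
  have hzm : G.Adj z m := dist_eq_one_iff_adj.1 (by omega)
  have hvm : v ≠ m := by rintro rfl; exact nadj ha.symm hx.au hxm.symm
  have ham : a ≠ m := by rintro rfl; exact nay hym.symm
  have hbm : b ≠ m := by rintro rfl; exact nbz hzm.symm
  have hcm : c ≠ m := by rintro rfl; exact ncx hxm.symm
  have hcx : c ≠ x := by rintro rfl; exact nadj ha hc hx.au
  have hay : a ≠ y := by rintro rfl; exact nadj hb ha hy.au
  have hbz : b ≠ z := by rintro rfl; exact nadj ha hb hz.au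
  refine spanCube_of ha hb hc hx.au hx.bu hy.au hy.bu hz.au hz.bu hxm hym hzm ?_
  simp only [List.nodup_cons, List.mem_cons, List.not_mem_nil, or_false, not_or]
  exact ⟨⟨hc.ne, hb.ne, hy.xu, ha.ne, hz.xu, hx.xu, hvm⟩,
    ⟨hbc.symm, hy.bu.ne, hac.symm, hz.bu.ne, hcx, hcm⟩, ⟨hy.au.ne, hab.symm, hbz, hx.bu.ne, hbm⟩,
    ⟨hay.symm, hyz, hxy.symm, hym.ne⟩, ⟨hz.au.ne, hx.au.ne, ham⟩, ⟨hzx, hzm.ne⟩, hxm.ne,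
    not_false, List.nodup_nil⟩

/-! ### Swap equivalence of words -/

/-- Swap equivalence of words. A word is a list of vertices, read as a path of `G` that ends at the
head of the list. Two words are swap equivalent if they differ by pushing subpaths `x, a, u` across
`4`-cycles `x, a, u, b`. The relation is given recursively, by what happens at the head: either the
tails are equivalent, or, after equivalences of the tails, one `4`-cycle is crossed at the head.
Transitivity is therefore a theorem, and inversion at the head is immediate. -/
inductive SwapEquiv (G : SimpleGraph V) : List V → List V → Prop
  | nil : SwapEquiv G [] []
  | cons (z : V) {p q : List V} : SwapEquiv G p q → SwapEquiv G (z :: p) (z :: q)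
  | square {z x u y : V} {p q r : List V} : Sq G z x u y → SwapEquiv G p (x :: u :: r) →
      SwapEquiv G q (y :: u :: r) → SwapEquiv G (z :: p) (z :: q)

namespace SwapEquiv

@[refl] lemma refl : ∀ p : List V, SwapEquiv G p p
  | [] => nil
  | z :: p => cons z (refl p)

lemma symm {p q : List V} (h : SwapEquiv G p q) : SwapEquiv G q p := by
  induction h with
  | nil => exact nil
  | cons z _ ih => exact cons z ih
  | square hs h1 h2 _ _ => exact square hs.reflect h2 h1

lemma length_eq {p q : List V} (h : SwapEquiv G p q) : p.length = q.length := by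
  induction h with
  | nil => rfl
  | cons z _ ih => simp [ih]
  | square _ _ _ ih1 ih2 => simp [ih1, ih2]

lemma head?_eq {p q : List V} (h : SwapEquiv G p q) : p.head? = q.head? := by
  cases h <;> rfl

lemma head_eq {x y : V} {p q : List V} (h : SwapEquiv G (x :: p) (y :: q)) : x = y := by
  simpa using h.head?_eq

lemma getLast?_eq {p q : List V} (h : SwapEquiv G p q) : p.getLast? = q.getLast? := by
  induction h with
  | nil => rfl
  | cons z _ ih => simp [List.getLast?_cons, ih]
  | square _ _ _ ih1 ih2 => simp [List.getLast?_cons, ih1, ih2]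

lemma isChain_iff {p q : List V} (h : SwapEquiv G p q) :
    p.IsChain G.Adj ↔ q.IsChain G.Adj := by
  induction h with
  | nil => rfl
  | cons z h ih => rw [List.isChain_cons, List.isChain_cons, ih, h.head?_eq]
  | square hs h1 h2 ih1 ih2 =>
    rw [List.isChain_cons, List.isChain_cons, ih1, ih2, h1.head?_eq, h2.head?_eq]
    simp [hs.xa, hs.xb, hs.au, hs.bu]

lemma inv {x y : V} {p q : List V} (h : SwapEquiv G (x :: p) (y :: q)) :
    SwapEquiv G p q ∨ ∃ a u b r, Sq G x a u b ∧ SwapEquiv G p (a :: u :: r) ∧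
      SwapEquiv G q (b :: u :: r) := by
  cases h with
  | cons _ h => exact Or.inl h
  | square hs h1 h2 => exact Or.inr ⟨_, _, _, _, hs, h1, h2⟩

/-- Inversion of a swap equivalence when the second vertices are displayed. -/
lemma inv_cons {z x y z' : V} {p q : List V} (h : SwapEquiv G (z :: x :: p) (z' :: y :: q)) :
    (x = y ∧ SwapEquiv G (x :: p) (y :: q)) ∨ ∃ u r, Sq G z x u y ∧
      SwapEquiv G (x :: p) (x :: u :: r) ∧ SwapEquiv G (y :: q) (y :: u :: r) := by
  rcases h.inv with h | ⟨a, u, b, r, hs, h1, h2⟩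
  · exact Or.inl ⟨h.head_eq, h⟩
  · obtain rfl := h1.head_eq
    obtain rfl := h2.head_eq
    exact Or.inr ⟨u, r, hs, h1, h2⟩

/-- Swap equivalence is transitive. When both steps cross a `4`-cycle at the head `z`, with common
second vertex `y`, the cube spanned at `y` provides the `4`-cycle for the composite. -/
lemma trans_aux (hu : UniqueSquares G) (hc : CubeCondition G) : ∀ (n : ℕ) (p q r : List V),
    q.length ≤ n → SwapEquiv G p q → SwapEquiv G q r → SwapEquiv G p r := by
  intro n
  induction n with
  | zero =>
    intro p q r hn h1 h2
    obtain rfl := List.eq_nil_of_length_eq_zero (Nat.le_zero.1 hn)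
    cases h1
    exact h2
  | succ n ih =>
    intro p q r hn h1 h2
    cases h1 with
    | nil => exact h2
    | @cons z p q h1 =>
      have hq : q.length ≤ n := by simpa using hn
      cases h2 with
      | cons _ h2 => exact cons z (ih _ _ _ hq h1 h2)
      | square hs h2 h3 => exact square hs (ih _ _ _ hq h1 h2) h3
    | @square z x u y p q s hs h1 h1' =>
      have hq : q.length ≤ n := by simpa using hn
      have ih' : ∀ {p q r : List V}, p.length ≤ n → SwapEquiv G p q → SwapEquiv G q r →
          SwapEquiv G p r := fun h h1 h2 => ih _ _ _ (h1.length_eq ▸ h) h1 h2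
      have hl : ∀ {l : List V}, SwapEquiv G q l → l.length ≤ n := fun h => h.length_eq ▸ hq
      cases h2 with
      | cons _ h2 =>
        exact square hs h1 (ih _ _ _ hq h2.symm h1')
      | @square _ y' u' x' _ r s' hs' h2 h2' =>
        have hm := ih _ _ _ hq h1'.symm h2
        obtain rfl := hm.head_eq
        have hpl : (x :: u :: s).length ≤ n := by
          have := hl h1'
          simpa using this
        have hrl : (x' :: u' :: s').length ≤ n := by
          have := hl h2
          simpa using this
        rcases hm.inv_cons with ⟨rfl, hm⟩ | ⟨t, k, ht, hm1, hm2⟩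
        · by_cases hx : x = x'
          · subst hx
            exact cons z (ih _ _ _ hpl h1 (ih' hpl (cons x hm) h2'.symm))
          · exact square ⟨hs.xa, hs.au, hs'.xb, hs'.bu, hs.xu, hx⟩ h1
              (ih _ _ _ hrl h2' (cons x' hm.symm))
        · -- The three neighbours `z`, `u`, `u'` of the common second vertex pairwise span
          -- `4`-cycles; the vertex `w` opposite to it in the cube closes the `4`-cycle at `z`.
          have hx : x ≠ x' := by
            rintro rfl
            exact ht.ab (hs.reflect.unique hu hs')
          have q1 : Sq G y z x u := hs.rotate.rotate.rotate
          have q2 : Sq G y z x' u' := hs'.rotate.reflect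
          obtain ⟨ab, bc, ac, w, c1, c2, c3, c4, c5, c6⟩ := (hc y z u u' q1.xa q1.xb q2.xb
            ⟨x, spanFourCycleWith_iff.2 q1⟩ ⟨t, spanFourCycleWith_iff.2 ht⟩
            ⟨x', spanFourCycleWith_iff.2 q2⟩).exists_tips
          obtain rfl := c1.unique hu q1
          obtain rfl := c2.unique hu ht
          obtain rfl := c3.unique hu q2
          refine square c4 (r := bc :: k) ?_ ?_
          · exact ih _ _ _ hpl h1 (ih' hpl (cons _ hm1)
              (square c5.rotate.reflect (refl _) (refl _)))
          · exact ih _ _ _ hrl h2' (ih' hrl (cons _ hm2)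
              (square c6.rotate.rotate.rotate (refl _) (refl _)))

lemma trans (hu : UniqueSquares G) (hc : CubeCondition G) {p q r : List V}
    (h1 : SwapEquiv G p q) (h2 : SwapEquiv G q r) : SwapEquiv G p r :=
  trans_aux hu hc _ p q r le_rfl h1 h2

end SwapEquiv

/-! ### Reduced words -/

/-- `x` is a descent of the word `w` if some word equivalent to `w` passes through `x` just before
its end point. -/
def Desc (G : SimpleGraph V) (w : List V) (x : V) : Prop :=
  ∃ z p, SwapEquiv G w (z :: x :: p)

/-- A word is reduced if no equivalent word backtracks. -/
def Reduced (G : SimpleGraph V) : List V → Prop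
  | [] => True
  | z :: w => Reduced G w ∧ ¬ Desc G w z

section Words

variable (hu : UniqueSquares G) (hc : CubeCondition G)
include hu hc

lemma SwapEquiv.desc_iff {p q : List V} (h : SwapEquiv G p q) (x : V) :
    Desc G p x ↔ Desc G q x :=
  ⟨fun ⟨z, r, hr⟩ => ⟨z, r, h.symm.trans hu hc hr⟩, fun ⟨z, r, hr⟩ => ⟨z, r, h.trans hu hc hr⟩⟩

/-- Being reduced survives pushing the end of the word `z, x, u, …` across a `4`-cycle at `z`. -/
lemma Sq.reduced {z x u y : V} {r : List V} (hs : Sq G z x u y) (h : Reduced G (x :: u :: r))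
    (hz : ¬ Desc G (x :: u :: r) z) : Reduced G (y :: u :: r) ∧ ¬ Desc G (y :: u :: r) z := by
  refine ⟨⟨h.1, ?_⟩, ?_⟩
  · rintro ⟨u', s, hus⟩
    obtain rfl := hus.head_eq
    exact hz ⟨x, y :: s, (SwapEquiv.cons x hus).trans hu hc
      (.square hs.rotate (.refl _) (.refl _))⟩
  · rintro ⟨y', s, hys⟩
    obtain rfl := hys.head_eq
    rcases hys.inv_cons with ⟨rfl, -⟩ | ⟨t, k, ht, h1, h2⟩
    · exact hs.xu rfl
    · obtain rfl := ht.unique hu hs.rotate.rotate.rotate.reflect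
      exact h.2 ⟨u, k, h1⟩

lemma SwapEquiv.reduced_iff {p q : List V} (h : SwapEquiv G p q) :
    Reduced G p ↔ Reduced G q := by
  induction h with
  | nil => rfl
  | cons z h ih => simp only [Reduced, ih, h.desc_iff hu hc]
  | square hs h1 h2 ih1 ih2 =>
    rw [Reduced, Reduced, h1.desc_iff hu hc, h2.desc_iff hu hc, ih1, ih2]
    exact ⟨fun h => hs.reduced hu hc h.1 h.2, fun h => hs.reflect.reduced hu hc h.1 h.2⟩

end Words

open Classical in
/-- The action of a vertex on words by prolonging and reducing: if `x` is a descent of `w`, undo the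
last step of an equivalent word that comes from `x`; otherwise prolong `w` to `x`. -/
noncomputable def stepTo (G : SimpleGraph V) (x : V) (w : List V) : List V :=
  if h : Desc G w x then x :: h.choose_spec.choose else x :: w

lemma stepTo_of_not_desc {x : V} {w : List V} (h : ¬ Desc G w x) : stepTo G x w = x :: w :=
  dif_neg h

/-- A reduced word which is a path from `v` to `z`. -/
structure IsWord (G : SimpleGraph V) (v z : V) (w : List V) : Prop where
  reduced : Reduced G w
  isChain : w.IsChain G.Adj
  head? : w.head? = some z
  getLast? : w.getLast? = some v

lemma IsWord.singleton (v : V) : IsWord G v v [v] :=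
  ⟨⟨trivial, by rintro ⟨z, p, h⟩; cases h⟩, List.isChain_singleton v, rfl, rfl⟩

lemma IsWord.eq_cons {v z : V} {w : List V} (h : IsWord G v z w) : ∃ p, w = z :: p := by
  cases w with
  | nil => exact absurd h.head? (by simp)
  | cons x p => exact ⟨p, by simpa using h.head?⟩

lemma IsWord.of_cons {v z x : V} {p : List V} (h : IsWord G v z (z :: x :: p)) :
    IsWord G v x (x :: p) ∧ G.Adj z x ∧ ¬ Desc G (x :: p) z :=
  ⟨⟨h.reduced.1, (List.isChain_cons_cons.1 h.isChain).2, rfl, by simpa using h.getLast?⟩,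
    (List.isChain_cons_cons.1 h.isChain).1, h.reduced.2⟩

lemma IsWord.cons {v z x : V} {w : List V} (h : IsWord G v z w) (hx : G.Adj z x)
    (hd : ¬ Desc G w x) : IsWord G v x (x :: w) := by
  obtain ⟨p, rfl⟩ := h.eq_cons
  exact ⟨⟨h.reduced, hd⟩, List.isChain_cons_cons.2 ⟨hx.symm, h.isChain⟩, rfl,
    by simpa using h.getLast?⟩

/-- The length of a word bounds the distance between its end points. -/
lemma dist_lt_length (hG : G.Connected) {v : V} : ∀ {w : List V} {z : V}, w.IsChain G.Adj →
    w.head? = some z → w.getLast? = some v → G.dist z v + 1 ≤ w.length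
  | [], _, _, h, _ => by simp at h
  | [x], z, _, h, h' => by
    obtain rfl : x = z := by simpa using h
    obtain rfl : x = v := by simpa using h'
    simp
  | x :: y :: p, z, hch, h, h' => by
    obtain rfl : x = z := by simpa using h
    obtain ⟨hxy, hch⟩ := List.isChain_cons_cons.1 hch
    have h1 := dist_lt_length (w := y :: p) (z := y) hG hch rfl (by simpa using h')
    have h2 := hG.dist_triangle (u := x) (v := y) (w := v)
    have h3 := dist_eq_one_iff_adj.2 hxy
    simp only [List.length_cons] at h1 ⊢
    omega

lemma Sq.not_desc_cons (hu : UniqueSquares G) {v z a c b : V} {w : List V}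
    (hs : Sq G z a c b) (h : IsWord G v z w) (hb : ¬ Desc G w b) : ¬ Desc G (a :: w) c := by
  rintro ⟨a', r, hr⟩
  obtain rfl := hr.head_eq
  obtain ⟨p, rfl⟩ := h.eq_cons
  rcases hr.inv_cons with ⟨rfl, -⟩ | ⟨t, k, ht, h1, -⟩
  · exact hs.xu rfl
  · obtain rfl := ht.unique hu hs.rotate.reflect
    exact hb ⟨z, k, h1⟩

section Action

variable (hu : UniqueSquares G) (hc : CubeCondition G)
include hu hc

lemma SwapEquiv.isWord {v z : V} {p q : List V} (h : SwapEquiv G p q) (hp : IsWord G v z p) :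
    IsWord G v z q :=
  ⟨(h.reduced_iff hu hc).1 hp.reduced, h.isChain_iff.1 hp.isChain, h.head?_eq ▸ hp.head?,
    h.getLast?_eq ▸ hp.getLast?⟩

lemma stepTo_of_equiv {x z : V} {w p : List V} (h : SwapEquiv G w (z :: x :: p)) :
    SwapEquiv G (stepTo G x w) (x :: p) := by
  have hd : Desc G w x := ⟨z, p, h⟩
  rw [stepTo, dif_pos hd]
  have h1 := hd.choose_spec.choose_spec.symm.trans hu hc h
  rcases h1.inv_cons with ⟨-, h1⟩ | ⟨u, r, hs, -, -⟩
  · exact h1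
  · exact absurd rfl hs.ab

lemma SwapEquiv.stepTo {p q : List V} (h : SwapEquiv G p q) (x : V) :
    SwapEquiv G (stepTo G x p) (stepTo G x q) := by
  by_cases hd : Desc G q x
  · obtain ⟨z, r, hr⟩ := hd
    exact (stepTo_of_equiv hu hc (h.trans hu hc hr)).trans hu hc (stepTo_of_equiv hu hc hr).symm
  · rw [stepTo_of_not_desc hd, stepTo_of_not_desc (mt (h.desc_iff hu hc x).1 hd)]
    exact .cons x h

/-- Either the word `w` ending at `z` is prolonged to `x`, or its last step is undone. -/
lemma IsWord.stepTo_cases {v z x : V} {w : List V} (h : IsWord G v z w) :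
    (¬ Desc G w x ∧ stepTo G x w = x :: w) ∨ ∃ p, SwapEquiv G w (z :: x :: p) ∧
      SwapEquiv G (stepTo G x w) (x :: p) ∧ ¬ Desc G (x :: p) z := by
  by_cases hd : Desc G w x
  · obtain ⟨z', p, hp⟩ := hd
    obtain ⟨q, rfl⟩ := h.eq_cons
    obtain rfl := hp.head_eq
    exact Or.inr ⟨p, hp, stepTo_of_equiv hu hc hp, (hp.isWord hu hc h).of_cons.2.2⟩
  · exact Or.inl ⟨hd, stepTo_of_not_desc hd⟩

lemma IsWord.stepTo {v z x : V} {w : List V} (h : IsWord G v z w) (hx : G.Adj z x) :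
    IsWord G v x (stepTo G x w) := by
  rcases h.stepTo_cases hu hc (x := x) with ⟨h1, h2⟩ | ⟨p, h1, h2, -⟩
  · rw [h2]
    exact h.cons hx h1
  · exact h2.symm.isWord hu hc (h1.isWord hu hc h).of_cons.1

/-- The steps along the two orientations of an edge are inverse to each other. -/
lemma IsWord.stepTo_stepTo {v z x : V} {w : List V} (h : IsWord G v z w) :
    SwapEquiv G (SimpleGraph.stepTo G z (SimpleGraph.stepTo G x w)) w := by
  rcases h.stepTo_cases hu hc (x := x) with ⟨-, h2⟩ | ⟨p, h1, h2, h3⟩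
  · obtain ⟨p, rfl⟩ := h.eq_cons
    exact stepTo_of_equiv hu hc (z := x) (by rw [h2])
  · refine (h2.stepTo hu hc z).trans hu hc ?_
    rw [stepTo_of_not_desc h3]
    exact h1.symm

/-- If `w` arrives at `z` from `a` but cannot arrive from `b`, then both ways from `z` to the
opposite vertex `c` of a `4`-cycle undo the step from `a` and prolong by the edge from `a` to `c`. -/
lemma Sq.stepTo_of_desc {z a c b : V} {w p : List V} (hs : Sq G z a c b)
    (ha : SwapEquiv G w (z :: a :: p)) (hb : ¬ Desc G w b) :
    SwapEquiv G (stepTo G c (stepTo G a w)) (c :: a :: p) ∧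
      SwapEquiv G (stepTo G c (stepTo G b w)) (c :: a :: p) := by
  constructor
  · refine ((stepTo_of_equiv hu hc ha).stepTo hu hc c).trans hu hc ?_
    rw [stepTo_of_not_desc]
    rintro ⟨a', r, hr⟩
    obtain rfl := hr.head_eq
    exact hb ⟨z, c :: r, ha.trans hu hc (.square hs hr (.refl _))⟩
  · rw [stepTo_of_not_desc hb]
    exact stepTo_of_equiv hu hc (z := b) ((SwapEquiv.cons b ha).trans hu hc
      (.square hs.reflect.rotate.reflect (.refl _) (.refl _)))

/-- The two ways around a `4`-cycle act in the same way on reduced words. -/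
lemma Sq.stepTo_stepTo {v z a c b : V} {w : List V} (hs : Sq G z a c b) (h : IsWord G v z w) :
    SwapEquiv G (stepTo G c (stepTo G a w)) (stepTo G c (stepTo G b w)) := by
  rcases h.stepTo_cases hu hc (x := a) with ⟨ha, ha'⟩ | ⟨p, ha, ha', -⟩ <;>
  rcases h.stepTo_cases hu hc (x := b) with ⟨hb, hb'⟩ | ⟨q, hb, hb', -⟩
  · rw [ha', hb', stepTo_of_not_desc (hs.not_desc_cons hu h hb),
      stepTo_of_not_desc (hs.reflect.not_desc_cons hu h ha)]
    obtain ⟨p, rfl⟩ := h.eq_cons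
    exact .square hs.rotate.rotate.reflect (.refl _) (.refl _)
  · have := hs.reflect.stepTo_of_desc hu hc hb ha
    exact this.2.trans hu hc this.1.symm
  · have := hs.stepTo_of_desc hu hc ha hb
    exact this.1.trans hu hc this.2.symm
  · rcases (ha.symm.trans hu hc hb).inv_cons with ⟨e, -⟩ | ⟨u, r, hs', h1, h2⟩
    · exact absurd e hs.ab
    · obtain rfl := hs.unique hu hs'
      exact ((ha'.trans hu hc h1).stepTo hu hc c |>.trans hu hc
        (stepTo_of_equiv hu hc (.refl _))).trans hu hc
        (((hb'.trans hu hc h2).stepTo hu hc c).trans hu hc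
          (stepTo_of_equiv hu hc (.refl _))).symm

end Action

/-! ### From trivial local systems to the quadrangle condition -/

/-- Every family of sets, indexed by the vertices, on which the edges act by bijections such that
both ways around each `4`-cycle agree, has a compatible family of elements through each given
element. -/
def LocalSystemsTrivial (G : SimpleGraph V) : Prop :=
  ∀ (F : V → Type u) (act : ∀ x y : V, G.Adj x y → F x → F y),
    (∀ x y h f, act y x h.symm (act x y h f) = f) →
    (∀ x a u b (h : Sq G x a u b) f,
      act a u h.au (act x a h.xa f) = act b u h.bu (act x b h.xb f)) →
    ∀ (v : V) (f : F v), ∃ s : ∀ x, F x, s v = f ∧ ∀ x y h, act x y h (s x) = s y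

section Geodesics

variable (hu : UniqueSquares G) (hc : CubeCondition G)
include hu hc

/-- If local systems are trivial, reduced words from `v` to `z` can be chosen compatibly with the
action of the edges. -/
lemma LocalSystemsTrivial.exists_words (hl : LocalSystemsTrivial G) (v : V) :
    ∃ w : V → List V, (∀ z, IsWord G v z (w z)) ∧ (w v).length = 1 ∧
      ∀ x y, G.Adj x y → SwapEquiv G (w y) (y :: w x) ∨ SwapEquiv G (w x) (x :: w y) := by
  let S : ∀ z, Setoid {w // IsWord G v z w} := fun z =>
    { r := fun p q => SwapEquiv G p.1 q.1
      iseqv := ⟨fun p => .refl _, fun h => h.symm, fun h h' => h.trans hu hc h'⟩ }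
  obtain ⟨s, hs, hs'⟩ := hl (fun z => Quotient (S z))
    (fun x y h => Quotient.map (sa := S x) (sb := S y)
      (fun p => ⟨stepTo G y p.1, p.2.stepTo hu hc h⟩) (fun p q h => SwapEquiv.stepTo hu hc h y))
    (by
      rintro x y h ⟨p⟩
      exact Quotient.sound (p.2.stepTo_stepTo hu hc))
    (by
      rintro x a u b h ⟨p⟩
      exact Quotient.sound (h.stepTo_stepTo hu hc p.2)) v (Quotient.mk _ ⟨[v], .singleton v⟩)
  have hw : ∀ x, Quotient.mk (S x) (s x).out = s x := fun x => Quotient.out_eq _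
  refine ⟨fun x => (s x).out.1, fun x => (s x).out.2, ?_, fun x y h => ?_⟩
  · rw [← hw v] at hs
    exact (show SwapEquiv G _ _ from Quotient.exact hs).length_eq
  · have h1 := hs' x y h
    rw [← hw x, ← hw y] at h1
    have h2 : SwapEquiv G (stepTo G y (s x).out.1) (s y).out.1 := Quotient.exact h1
    rcases (s x).out.2.stepTo_cases hu hc (x := y) with ⟨-, h3⟩ | ⟨p, h3, h4, -⟩
    · rw [h3] at h2
      exact Or.inl h2.symm
    · exact Or.inr (h3.trans hu hc (.cons x (h4.symm.trans hu hc h2)))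

/-- The compatible words are geodesics. -/
lemma LocalSystemsTrivial.exists_geodesics (hl : LocalSystemsTrivial G) (hG : G.Connected)
    (v : V) : ∃ w : V → List V, (∀ z, IsWord G v z (w z)) ∧
      (∀ z, (w z).length = G.dist z v + 1) ∧
      ∀ x y, G.Adj x y → SwapEquiv G (w y) (y :: w x) ∨ SwapEquiv G (w x) (x :: w y) := by
  obtain ⟨w, h1, h2, h3⟩ := hl.exists_words hu hc v
  refine ⟨w, h1, fun z => le_antisymm ?_
    (dist_lt_length hG (h1 z).isChain (h1 z).head? (h1 z).getLast?), h3⟩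
  have key : ∀ {x y : V} (p : G.Walk x y), (w x).length ≤ p.length + (w y).length := by
    intro x y p
    induction p with
    | nil => simp
    | @cons x x' y h p ih =>
      have := (h3 x x' h).imp SwapEquiv.length_eq SwapEquiv.length_eq
      simp only [List.length_cons, Walk.length_cons] at this ⊢
      omega
  obtain ⟨p, hp⟩ := hG.exists_walk_length_eq_dist z v
  have := key p
  omega

lemma LocalSystemsTrivial.distParity (hl : LocalSystemsTrivial G) (hG : G.Connected) :
    DistParity G := by
  intro v x y h he
  obtain ⟨w, -, h2, h3⟩ := hl.exists_geodesics hu hc hG v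
  have := (h3 x y h).imp SwapEquiv.length_eq SwapEquiv.length_eq
  simp only [List.length_cons, h2] at this
  omega

lemma LocalSystemsTrivial.quadrangleCondition (hl : LocalSystemsTrivial G) (hG : G.Connected) :
    QuadrangleCondition G := by
  intro v z x y hx hy hxy hxd hyd
  obtain ⟨w, h1, h2, h3⟩ := hl.exists_geodesics hu hc hG v
  have down : ∀ {x : V}, G.Adj z x → G.dist z v = G.dist x v + 1 →
      SwapEquiv G (w z) (z :: w x) := by
    intro x hx hd
    refine (h3 x z hx.symm).resolve_right fun h => ?_
    have := h.length_eq
    simp only [List.length_cons, h2] at this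
    omega
  have hxw := h1 x
  have hyw := h1 y
  have hlen := h2 x
  have heq := (down hx hxd).symm.trans hu hc (down hy hyd)
  obtain ⟨p, hp⟩ := (h1 x).eq_cons
  obtain ⟨q, hq⟩ := (h1 y).eq_cons
  rw [hp, hq] at heq
  rcases heq.inv_cons with ⟨e, -⟩ | ⟨u, r, hs, hr, -⟩
  · exact absurd e hxy
  · refine ⟨u, hs.au, hs.bu, ?_⟩
    rw [hp] at hxw hlen
    have hur := (hr.isWord hu hc hxw).of_cons.1
    have h4 := dist_lt_length hG hur.isChain hur.head? hur.getLast?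
    have h5 := hr.length_eq
    have h6 := hG.dist_triangle (u := x) (v := u) (w := v)
    have h7 := dist_eq_one_iff_adj.2 hs.au
    simp only [List.length_cons] at h4 h5 hlen
    omega

/-- A connected graph with trivial local systems satisfying the two local conditions is median. -/
theorem LocalSystemsTrivial.isMedian (hl : LocalSystemsTrivial G) (hG : G.Connected) :
    G.IsMedian :=
  (hl.quadrangleCondition hu hc hG).isMedian (hl.distParity hu hc hG) hu hG

end Geodesics

/-! ### Open stars of the square-completion -/

namespace Cells

/-- A point of a closed cell is near the vertex `v` if `v` is a vertex of the unique open face of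
the cell that contains the point. -/
def Near (v : V) : Cells G → Prop
  | .inl ⟨u, _⟩ => u = v
  | .inr (.inl ⟨e, t⟩) => (e.fst = v ∧ t < 1) ∨ (e.snd = v ∧ 0 < t)
  | .inr (.inr ⟨q, p⟩) => (q.a = v ∧ p.1 < 1 ∧ p.2 < 1) ∨ (q.b = v ∧ 0 < p.1 ∧ p.2 < 1) ∨
      (q.c = v ∧ 0 < p.1 ∧ 0 < p.2) ∨ (q.d = v ∧ p.1 < 1 ∧ 0 < p.2)

lemma near_vertexPoint {v u : V} : Near v (vertexPoint (G := G) u) ↔ u = v := Iff.rfl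

lemma near_edgePoint {v : V} {e : G.Dart} {t : I} :
    Near v (edgePoint e t) ↔ (e.fst = v ∧ t < 1) ∨ (e.snd = v ∧ 0 < t) := Iff.rfl

lemma near_squarePoint {v : V} {q : FourCycle G} {s t : I} :
    Near v (squarePoint q s t) ↔ (q.a = v ∧ s < 1 ∧ t < 1) ∨ (q.b = v ∧ 0 < s ∧ t < 1) ∨
      (q.c = v ∧ 0 < s ∧ 0 < t) ∨ (q.d = v ∧ s < 1 ∧ 0 < t) := Iff.rfl

/-- To be open in the disjoint union of the cells is to be open in each cell. -/
lemma isOpen_iff {s : Set (Cells G)} : IsOpen s ↔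
    (∀ e : G.Dart, IsOpen {t : I | edgePoint e t ∈ s}) ∧
      ∀ q : FourCycle G, IsOpen {p : I × I | squarePoint q p.1 p.2 ∈ s} := by
  rw [isOpen_sum_iff, isOpen_sum_iff, isOpen_sigma_iff, isOpen_sigma_iff, isOpen_sigma_iff]
  exact ⟨fun h => h.2, fun h => ⟨fun _ => isOpen_discrete _, h⟩⟩

lemma isOpen_near (v : V) : IsOpen {c : Cells G | Near v c} := by
  rw [isOpen_iff]
  refine ⟨fun e => ?_, fun q => ?_⟩
  · exact (isOpen_const.and (isOpen_lt continuous_id continuous_const)).union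
      (isOpen_const.and (isOpen_lt continuous_const continuous_id))
  · have h1 : IsOpen {p : I × I | p.1 < 1} := isOpen_lt continuous_fst continuous_const
    have h2 : IsOpen {p : I × I | p.2 < 1} := isOpen_lt continuous_snd continuous_const
    have h3 : IsOpen {p : I × I | 0 < p.1} := isOpen_lt continuous_const continuous_fst
    have h4 : IsOpen {p : I × I | 0 < p.2} := isOpen_lt continuous_const continuous_snd
    exact (isOpen_const.and (h1.and h2)).union ((isOpen_const.and (h3.and h2)).union
      ((isOpen_const.and (h3.and h4)).union (isOpen_const.and (h1.and h4))))

lemma symm_lt_one {t : I} : unitInterval.symm t < 1 ↔ 0 < t := by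
  rw [← unitInterval.symm_zero, unitInterval.symm_lt_symm]

lemma zero_lt_symm {t : I} : 0 < unitInterval.symm t ↔ t < 1 := by
  rw [← unitInterval.symm_one, unitInterval.symm_lt_symm]

lemma Glue.near_iff {c c' : Cells G} (h : Glue c c') (v : V) : Near v c ↔ Near v c' := by
  cases h with
  | edge_source e => simp [near_edgePoint, near_vertexPoint]
  | edge_symm e t =>
    simp only [near_edgePoint, symm_lt_one, zero_lt_symm, Dart.symm, Prod.fst_swap, Prod.snd_swap]
    tauto
  | square_side q s =>
    simp [near_edgePoint, near_squarePoint, FourCycle.firstDart]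
  | square_rotate q s t =>
    simp only [near_squarePoint, symm_lt_one, zero_lt_symm, FourCycle.rotate]
    tauto
  | square_reflect q s t =>
    simp only [near_squarePoint, FourCycle.reflect]
    tauto

lemma exists_near (c : Cells G) : ∃ v, Near v c := by
  rcases c with ⟨u, _⟩ | ⟨e, t⟩ | ⟨q, s, t⟩
  · exact ⟨u, rfl⟩
  · rcases lt_or_ge t 1 with h | h
    · exact ⟨e.fst, Or.inl ⟨rfl, h⟩⟩
    · exact ⟨e.snd, Or.inr ⟨rfl, zero_lt_one.trans_le h⟩⟩
  · rcases lt_or_ge s 1 with h | h <;> rcases lt_or_ge t 1 with h' | h'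
    · exact ⟨q.a, Or.inl ⟨rfl, h, h'⟩⟩
    · exact ⟨q.d, Or.inr (Or.inr (Or.inr ⟨rfl, h, zero_lt_one.trans_le h'⟩))⟩
    · exact ⟨q.b, Or.inr (Or.inl ⟨rfl, zero_lt_one.trans_le h, h'⟩)⟩
    · exact ⟨q.c, Or.inr (Or.inr (Or.inl
        ⟨rfl, zero_lt_one.trans_le h, zero_lt_one.trans_le h'⟩))⟩

end Cells

namespace SquareCompletion
open Cells

/-- The point of the square-completion represented by a point of a closed cell. -/
def mk (c : Cells G) : G.SquareCompletion := Quot.mk _ c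

lemma mk_eq {c c' : Cells G} (h : Glue c c') : mk c = mk c' := Quot.sound h

lemma isQuotientMap_mk : IsQuotientMap (mk (G := G)) := isQuotientMap_quot_mk

lemma continuous_mk : Continuous (mk (G := G)) := isQuotientMap_mk.continuous

lemma mk_surjective : Function.Surjective (mk (G := G)) := Quot.mk_surjective

/-- The point of the square-completion belonging to a vertex. -/
def vertex (v : V) : G.SquareCompletion := mk (vertexPoint v)

lemma mk_edge_zero (e : G.Dart) : mk (edgePoint e 0) = vertex e.fst := mk_eq (.edge_source e)

lemma mk_edge_symm (e : G.Dart) (t : I) :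
    mk (edgePoint e t) = mk (edgePoint e.symm (unitInterval.symm t)) := mk_eq (.edge_symm e t)

lemma mk_edge_one (e : G.Dart) : mk (edgePoint e 1) = vertex e.snd := by
  rw [mk_edge_symm, unitInterval.symm_one, mk_edge_zero]
  rfl

/-- The relation `Near` on the square-completion. -/
def Near (v : V) : G.SquareCompletion → Prop :=
  Quot.lift (Cells.Near v) fun _ _ h => propext (h.near_iff v)

/-- The open star of a vertex: the union of the open cells which have it as a vertex. -/
def star (G : SimpleGraph V) (v : V) : Set G.SquareCompletion := {x | Near v x}

lemma isOpen_star (v : V) : IsOpen (star G v) :=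
  isQuotientMap_mk.isOpen_preimage.1 (isOpen_near v)

lemma vertex_mem_star {u v : V} : (vertex u : G.SquareCompletion) ∈ star G v ↔ u = v := Iff.rfl

lemma exists_mem_star (x : G.SquareCompletion) : ∃ v, x ∈ star G v := by
  obtain ⟨c, rfl⟩ := mk_surjective x
  exact exists_near c

instance : LocallyPathConnectedSpace I := (convex_Icc (0 : ℝ) 1).locallyPathConnectedSpace

instance : LocallyPathConnectedSpace G.SquareCompletion :=
  inferInstanceAs (LocallyPathConnectedSpace (Quot (Cells.Glue (G := G))))

/-- The square-completion maps to the set of components of the graph. -/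
def component : G.SquareCompletion → G.ConnectedComponent :=
  Quot.lift (fun c => match c with
    | .inl ⟨u, _⟩ => G.connectedComponentMk u
    | .inr (.inl ⟨e, _⟩) => G.connectedComponentMk e.fst
    | .inr (.inr ⟨q, _⟩) => G.connectedComponentMk q.a) (by
    intro c c' h
    cases h with
    | edge_source e => rfl
    | edge_symm e t => exact ConnectedComponent.sound e.adj.reachable
    | square_side q s => rfl
    | square_rotate q s t => exact ConnectedComponent.sound q.adj_ab.reachable
    | square_reflect q s t => rfl)

lemma connected_of_connectedSpace [ConnectedSpace G.SquareCompletion] : G.Connected := by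
  let _ : TopologicalSpace G.ConnectedComponent := ⊥
  have : DiscreteTopology G.ConnectedComponent := ⟨rfl⟩
  have hc : Continuous (component (G := G)) := by
    refine ⟨fun s _ => isQuotientMap_mk.isOpen_preimage.1 (Cells.isOpen_iff.2 ⟨?_, ?_⟩)⟩
    · exact fun e => isOpen_const (p := G.connectedComponentMk e.fst ∈ s)
    · exact fun q => isOpen_const (p := G.connectedComponentMk q.a ∈ s)
  obtain ⟨v, -⟩ := exists_mem_star (Classical.arbitrary G.SquareCompletion)
  have : Nonempty V := ⟨v⟩
  refine ⟨fun u v => ConnectedComponent.exact ?_⟩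
  exact PreconnectedSpace.constant inferInstance hc (x := vertex u) (y := vertex v)

end SquareCompletion

/-! ### Voltage assignments and their transition functions -/

/-- A voltage assignment with values in a group: an element for every oriented edge, inverse for the
two orientations, such that the products along both ways around each `4`-cycle agree. The values at
pairs of nonadjacent vertices are irrelevant. -/
structure IsVoltage (G : SimpleGraph V) {Γ : Type*} [Group Γ] (g : V → V → Γ) : Prop where
  inv : ∀ {x y}, G.Adj x y → g y x * g x y = 1
  square : ∀ {x a u b}, Sq G x a u b → g a u * g x a = g b u * g x b

section Voltage

variable {Γ : Type*} [Group Γ]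

open Classical in
/-- The product of the voltages along a path inside a closed cell from its base vertex to its
vertex `w`. The value is irrelevant if `w` is not a vertex of the cell. -/
noncomputable def Cells.potential (g : V → V → Γ) (w : V) : Cells G → Γ
  | .inl _ => 1
  | .inr (.inl ⟨e, _⟩) => if e.snd = w then g e.fst e.snd else 1
  | .inr (.inr ⟨q, _⟩) =>
      if q.b = w then g q.a q.b else if q.c = w then g q.b q.c * g q.a q.b
      else if q.d = w then g q.a q.d else 1

open Cells

variable {g : V → V → Γ}

lemma FourCycle.sq (q : FourCycle G) : Sq G q.a q.b q.c q.d :=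
  ⟨q.adj_ab, q.adj_bc, q.adj_da.symm, q.adj_cd.symm, q.a_ne_c, q.b_ne_d⟩

/-- Glueing changes potentials by a right translation only. -/
lemma IsVoltage.exists_potential_eq (hg : IsVoltage G g) {c c' : Cells G} (h : Glue c c') :
    ∃ k : Γ, ∀ v, Near v c → potential g v c = potential g v c' * k := by
  cases h with
  | edge_source e =>
    refine ⟨1, fun v hv => ?_⟩
    obtain rfl : e.fst = v := by simpa [near_edgePoint] using hv
    simp [potential, edgePoint, vertexPoint, e.adj.ne']
  | edge_symm e t =>
    refine ⟨g e.fst e.snd, fun v hv => ?_⟩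
    rcases hv with ⟨rfl, -⟩ | ⟨rfl, -⟩
    · simp [potential, edgePoint, Dart.symm, e.adj.ne', hg.inv e.adj]
    · simp [potential, edgePoint, Dart.symm, e.adj.ne]
  | square_side q s =>
    refine ⟨1, fun v hv => ?_⟩
    have hs := q.sq
    have hv' : q.a = v ∨ q.b = v := by
      simp only [near_squarePoint, lt_irrefl, and_false, or_false] at hv
      tauto
    rcases hv' with rfl | rfl
    · simp [potential, edgePoint, squarePoint, FourCycle.firstDart, hs.xa.ne', hs.xb.ne',
        hs.xu.symm]
    · simp [potential, edgePoint, squarePoint, FourCycle.firstDart]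
  | square_rotate q s t =>
    refine ⟨g q.a q.b, fun v hv => ?_⟩
    have hs := q.sq
    have h1 := hg.inv hs.xa
    have h2 := hg.square hs
    have h3 := hg.inv hs.bu
    rcases hv with ⟨rfl, -⟩ | ⟨rfl, -⟩ | ⟨rfl, -⟩ | ⟨rfl, -⟩
    · simp [potential, squarePoint, FourCycle.rotate, hs.xa.ne', hs.xb.ne', hs.xu.symm, h1]
    · simp [potential, squarePoint, FourCycle.rotate, hs.xa.ne, hs.au.ne', hs.ab.symm]
    · simp [potential, squarePoint, FourCycle.rotate, hs.au.ne]
    · simp [potential, squarePoint, FourCycle.rotate, hs.bu.ne', hs.ab, mul_assoc, h2]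
      rw [← mul_assoc, h3, one_mul]
  | square_reflect q s t =>
    refine ⟨1, fun v hv => ?_⟩
    have hs := q.sq
    have h2 := hg.square hs
    rcases hv with ⟨rfl, -⟩ | ⟨rfl, -⟩ | ⟨rfl, -⟩ | ⟨rfl, -⟩
    · simp [potential, squarePoint, FourCycle.reflect, hs.xa.ne', hs.xb.ne', hs.xu.symm]
    · simp [potential, squarePoint, FourCycle.reflect, hs.ab.symm, hs.au.ne']
    · simp [potential, squarePoint, FourCycle.reflect, hs.au.ne, hs.bu.ne, h2]
    · simp [potential, squarePoint, FourCycle.reflect, hs.ab, hs.bu.ne']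

open Classical in
/-- The transition element from `v` to `w` at a point: the product of the voltages along a path from
`v` to `w` in a cell containing the point, if the point lies in the open stars of both vertices. -/
noncomputable def Cells.transition (g : V → V → Γ) (v w : V) (c : Cells G) : Γ :=
  if Near v c ∧ Near w c then potential g w c * (potential g v c)⁻¹ else 1

lemma IsVoltage.transition_eq (hg : IsVoltage G g) {c c' : Cells G} (h : Glue c c') (v w : V) :
    transition g v w c = transition g v w c' := by
  unfold transition
  rw [h.near_iff v, h.near_iff w]
  split_ifs with hn
  · obtain ⟨k, hk⟩ := hg.exists_potential_eq h
    rw [hk v ((h.near_iff v).2 hn.1), hk w ((h.near_iff w).2 hn.2)]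
    group
  · rfl

namespace SquareCompletion

/-- The transition elements on the square-completion. -/
noncomputable def transition (hg : IsVoltage G g) (v w : V) : G.SquareCompletion → Γ :=
  Quot.lift (Cells.transition g v w) fun _ _ h => hg.transition_eq h v w

lemma transition_mk (hg : IsVoltage G g) {v w : V} {c : Cells G} (hv : Cells.Near v c)
    (hw : Cells.Near w c) :
    transition hg v w (mk c) = potential g w c * (potential g v c)⁻¹ :=
  if_pos ⟨hv, hw⟩

lemma transition_self (hg : IsVoltage G g) {v : V} {x : G.SquareCompletion} (hv : x ∈ star G v) :
    transition hg v v x = 1 := by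
  obtain ⟨c, rfl⟩ := mk_surjective x
  rw [transition_mk hg hv hv, mul_inv_cancel]

lemma transition_comp (hg : IsVoltage G g) {u v w : V} {x : G.SquareCompletion}
    (hu : x ∈ star G u) (hv : x ∈ star G v) (hw : x ∈ star G w) :
    transition hg v w x * transition hg u v x = transition hg u w x := by
  obtain ⟨c, rfl⟩ := mk_surjective x
  rw [transition_mk hg hu hv, transition_mk hg hv hw, transition_mk hg hu hw]
  group

/-- Transition elements are locally constant. -/
lemma isOpen_transition_eq (hg : IsVoltage G g) (v w : V) (k : Γ) :
    IsOpen {x | x ∈ star G v ∧ x ∈ star G w ∧ transition hg v w x = k} := by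
  rw [← isQuotientMap_mk.isOpen_preimage]
  have h : mk ⁻¹' {x | x ∈ star G v ∧ x ∈ star G w ∧ transition hg v w x = k} =
      {c | Cells.Near v c} ∩ ({c | Cells.Near w c} ∩
        {c | potential g w c * (potential g v c)⁻¹ = k}) := by
    ext c
    refine and_congr_right fun hv => and_congr_right fun hw => ?_
    rw [transition_mk hg hv hw]
    rfl
  rw [h]
  -- Potentials are constant on each closed cell.
  refine (isOpen_near v).inter ((isOpen_near w).inter
    (Cells.isOpen_iff.2 ⟨fun e => ?_, fun q => ?_⟩))
  · exact isOpen_const (p := potential g w (edgePoint e 0) * (potential g v (edgePoint e 0))⁻¹ = k)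
  · exact isOpen_const
      (p := potential g w (squarePoint q 0 0) * (potential g v (squarePoint q 0 0))⁻¹ = k)

end SquareCompletion

end Voltage

/-! ### The covering associated with a local system -/

namespace SquareCompletion

variable {S : Type u} {g : V → V → Equiv.Perm S}

/-- The bundle over the square-completion with fibre `S` which is trivial over open stars and has
the transition functions given by a voltage assignment in the permutations of `S`. -/
noncomputable def bundleCore [TopologicalSpace S] [DiscreteTopology S] (hg : IsVoltage G g) :
    FiberBundleCore V G.SquareCompletion S where
  baseSet := star G
  isOpen_baseSet := isOpen_star
  indexAt x := (exists_mem_star x).choose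
  mem_baseSet_at x := (exists_mem_star x).choose_spec
  coordChange v w x := ⇑(transition hg v w x)
  coordChange_self v x hx f := by rw [transition_self hg hx, Equiv.Perm.one_apply]
  continuousOn_coordChange v w := by
    rintro ⟨x, f⟩ ⟨⟨hv, hw⟩, -⟩
    refine ContinuousAt.continuousWithinAt ?_
    have h : ∀ᶠ p : G.SquareCompletion × S in 𝓝 (x, f),
        transition hg v w x p.2 = transition hg v w p.1 p.2 := by
      have := (isOpen_transition_eq hg v w (transition hg v w x)).mem_nhds ⟨hv, hw, rfl⟩
      filter_upwards [continuous_fst.continuousAt.preimage_mem_nhds this] with p hp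
      rw [hp.2.2]
    exact ContinuousAt.congr (continuous_of_discreteTopology.comp continuous_snd).continuousAt h
  coordChange_comp u v w x hx f := by
    rw [← transition_comp hg hx.1.1 hx.1.2 hx.2, Equiv.Perm.mul_apply]

/-- Over a simply connected square-completion, a voltage assignment in the permutations of `S` has
compatible families of elements of `S`: they come from sections of the associated covering. -/
lemma exists_section [SimplyConnectedSpace G.SquareCompletion] (hg : IsVoltage G g) (v : V)
    (f : S) : ∃ s : V → S, s v = f ∧ ∀ x y, G.Adj x y → g x y (s x) = s y := by
  let _ : TopologicalSpace S := ⊥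
  have : DiscreteTopology S := ⟨rfl⟩
  let Z := bundleCore hg
  have hcov : IsCoveringMap (Bundle.TotalSpace.proj (F := S) (E := Z.Fiber)) :=
    FiberBundle.isCoveringMap
  obtain ⟨sec, ⟨hsec, hsec'⟩, -⟩ := hcov.existsUnique_continuousMap_lifts
    (ContinuousMap.id G.SquareCompletion) (vertex v) ⟨vertex v, f⟩ rfl
  have hproj : ∀ x, (sec x).proj = x := fun x => congrFun hsec' x
  let coord : V → G.SquareCompletion → S := fun w x => (Z.localTriv w (sec x)).2
  have hcoord : ∀ w, ContinuousOn (coord w) (star G w) := by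
    intro w
    refine continuous_snd.comp_continuousOn ((Z.localTriv w).continuousOn.comp
      sec.continuous.continuousOn fun x hx => ?_)
    change (sec x).proj ∈ star G w
    rw [hproj]
    exact hx
  let fib : G.SquareCompletion → S := fun x => (sec x).2
  have hfib : fib (vertex v) = f := congrArg (fun p : Z.TotalSpace => (p.2 : S)) hsec
  have hval : ∀ w x, coord w x = transition hg (Z.indexAt x) w x (fib x) := by
    intro w x
    change transition hg (Z.indexAt (sec x).proj) w (sec x).proj (fib x) = _
    rw [hproj]
  have hchange : ∀ w w' x, x ∈ star G w → x ∈ star G w' →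
      coord w' x = transition hg w w' x (coord w x) := by
    intro w w' x hw hw'
    rw [hval, hval, ← Equiv.Perm.mul_apply, transition_comp hg (Z.mem_baseSet_at x) hw hw']
  refine ⟨fun w => coord w (vertex w), ?_, fun x y h => ?_⟩
  · have hi : v = Z.indexAt (vertex v) := Z.mem_baseSet_at (vertex v)
    simp only [hval, ← hi]
    rw [transition_self hg (vertex_mem_star.2 rfl), Equiv.Perm.one_apply, hfib]
  · let e : G.Dart := ⟨(x, y), h⟩
    let γ : I → G.SquareCompletion := fun t => mk (Cells.edgePoint e t)
    have hγ : Continuous γ := continuous_mk.comp (continuous_inr.comp (continuous_inl.comp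
      continuous_sigmaMk))
    obtain ⟨m, hm0, hm1⟩ : ∃ m : I, 0 < m ∧ m < 1 := exists_between zero_lt_one
    have hx : ∀ t : I, t < 1 → γ t ∈ star G x := fun t ht => Or.inl ⟨rfl, ht⟩
    have hy : ∀ t : I, 0 < t → γ t ∈ star G y := fun t ht => Or.inr ⟨rfl, ht⟩
    -- The coordinate at `x` is constant on the edge without its end point `y`, and conversely.
    have h1 : coord x (γ m) = coord x (γ 0) := by
      refine (isPreconnected_Iio (a := (1 : I))).constant (f := fun t => coord x (γ t)) ?_ hm1
        (Set.mem_Iio.2 zero_lt_one)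
      exact (hcoord x).comp hγ.continuousOn fun t ht => hx t ht
    have h2 : coord y (γ m) = coord y (γ 1) := by
      refine (isPreconnected_Ioi (a := (0 : I))).constant (f := fun t => coord y (γ t)) ?_ hm0
        (Set.mem_Ioi.2 zero_lt_one)
      exact (hcoord y).comp hγ.continuousOn fun t ht => hy t ht
    have e0 : γ 0 = vertex x := mk_edge_zero e
    have e1 : γ 1 = vertex y := mk_edge_one e
    have h3 : transition hg x y (γ m) = g x y := by
      rw [transition_mk hg (c := Cells.edgePoint e m) (hx m hm1) (hy m hm0)]
      simp [Cells.potential, Cells.edgePoint, e, h.ne']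
    change g x y (coord x (vertex x)) = coord y (vertex y)
    rw [← e0, ← e1, ← h1, ← h2, hchange x y _ (hx m hm1) (hy m hm0), h3]

/-- Local systems on a graph with simply connected square-completion are trivial. Identifying all
sets of the system with the one at a base vertex turns it into a voltage assignment. -/
theorem localSystemsTrivial [SimplyConnectedSpace G.SquareCompletion] :
    LocalSystemsTrivial G := by
  intro F act hinv hsq v f
  have hG : G.Connected := connected_of_connectedSpace
  let E : ∀ x y, G.Adj x y → (F x ≃ F y) := fun x y h =>
    ⟨act x y h, act y x h.symm, hinv x y h, hinv y x h.symm⟩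
  have hE : ∀ x, Nonempty (F v ≃ F x) := by
    intro x
    obtain ⟨p⟩ := hG.preconnected x v
    induction p with
    | nil => exact ⟨Equiv.refl _⟩
    | @cons x y v h p ih =>
      obtain ⟨e⟩ := ih f
      exact ⟨e.trans (E y x h.symm)⟩
  let θ := fun x => (hE x).some
  classical
  let g : V → V → Equiv.Perm (F v) := fun x y =>
    if h : G.Adj x y then (θ x).trans ((E x y h).trans (θ y).symm) else 1
  have hgE : ∀ {x y} (h : G.Adj x y) (a : F v), g x y a = (θ y).symm (act x y h (θ x a)) := by
    intro x y h a
    simp only [g, dif_pos h]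
    rfl
  have hg : IsVoltage G g := by
    constructor
    · intro x y h
      ext a
      rw [Equiv.Perm.mul_apply, hgE h, hgE h.symm]
      simp [hinv]
    · intro x a u b h
      ext c
      rw [Equiv.Perm.mul_apply, Equiv.Perm.mul_apply, hgE h.xa, hgE h.au, hgE h.xb, hgE h.bu]
      simp [hsq x a u b h]
  obtain ⟨s, hs, hs'⟩ := exists_section hg v ((θ v).symm f)
  refine ⟨fun x => θ x (s x), by simp [hs], fun x y h => ?_⟩
  simp [← hs' x y h, hgE h]

end SquareCompletion

end SimpleGraph

/-! ### A criterion for simple connectivity -/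

section PathClasses

open Path

variable {X A : Type*} [TopologicalSpace X] [TopologicalSpace A] {x₀ : X}

lemma Path.Homotopic.Quotient.mk_cast_trans_iff (c : ∀ x, Path.Homotopic.Quotient x x₀)
    {x y x' y' : X} (hx : x' = x) (hy : y' = y) (γ : Path x y) :
    (Homotopic.Quotient.mk (γ.cast hx hy)).trans (c y') = c x' ↔
      (Homotopic.Quotient.mk γ).trans (c y) = c x := by
  subst hx hy
  rfl

/-- A family `c` of path classes to a base point which is compatible with all paths inside the
members of an open cover is compatible with all paths. -/
lemma Path.Homotopic.Quotient.trans_eq_of_open_cover {ι : Type*} {U : ι → Set X}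
    (hU : ∀ i, IsOpen (U i)) (hcov : ∀ x, ∃ i, x ∈ U i)
    (c : ∀ x, Path.Homotopic.Quotient x x₀)
    (hc : ∀ i x y (γ : Path x y), (∀ t, γ t ∈ U i) → (Homotopic.Quotient.mk γ).trans (c y) = c x)
    {x y : X} (γ : Path x y) : (Homotopic.Quotient.mk γ).trans (c y) = c x := by
  obtain ⟨t, h0, hmono, ⟨n, hn⟩, ht⟩ := exists_monotone_Icc_subset_open_cover_unitInterval
    (c := fun i => γ ⁻¹' U i) (fun i => (hU i).preimage γ.continuous) (fun s _ => by
      obtain ⟨i, hi⟩ := hcov (γ s)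
      exact Set.mem_iUnion.2 ⟨i, hi⟩)
  have key : ∀ k, (Homotopic.Quotient.mk (γ.subpath (t 0) (t k))).trans (c (γ (t k))) =
      c (γ (t 0)) := by
    intro k
    induction k with
    | zero => rw [Path.subpath_self, Homotopic.Quotient.mk_refl, Homotopic.Quotient.refl_trans]
    | succ k ih =>
      obtain ⟨i, hi⟩ := ht k
      have h1 := hc i _ _ (γ.subpath (t k) (t (k + 1))) (fun s => by
        have : γ.subpath (t k) (t (k + 1)) s ∈ Set.range (γ.subpath (t k) (t (k + 1))) := ⟨s, rfl⟩
        rw [Path.range_subpath_of_le _ _ _ (hmono k.le_succ)] at this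
        obtain ⟨r, hr, hr'⟩ := this
        rw [← hr']
        exact hi hr)
      rw [← ih, ← h1, ← Homotopic.Quotient.trans_assoc, ← Homotopic.Quotient.mk_trans,
        Homotopic.Quotient.eq.2 ⟨Path.Homotopy.subpathTransSubpath γ (t 0) (t k) (t (k + 1))⟩]
  have h1 := key n
  rw [hn n le_rfl, h0, Path.subpath_zero_one] at h1
  exact (mk_cast_trans_iff c _ _ γ).1 h1

/-- A space is simply connected if it has a family of path classes to a base point which is
compatible with all paths inside the members of an open cover. -/
lemma SimplyConnectedSpace.of_open_cover {ι : Type*} {U : ι → Set X}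
    (hU : ∀ i, IsOpen (U i)) (hcov : ∀ x, ∃ i, x ∈ U i)
    (c : ∀ x, Path.Homotopic.Quotient x x₀)
    (hc : ∀ i x y (γ : Path x y), (∀ t, γ t ∈ U i) → (Homotopic.Quotient.mk γ).trans (c y) = c x) :
    SimplyConnectedSpace X := by
  have hj : ∀ x, Joined x x₀ := fun x => by
    obtain ⟨γ, -⟩ := Homotopic.Quotient.mk_surjective (c x)
    exact ⟨γ⟩
  rw [simply_connected_iff_paths_homotopic']
  refine ⟨⟨⟨x₀⟩, fun x y => (hj x).trans (hj y).symm⟩, fun {x y} γ δ => ?_⟩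
  rw [← Homotopic.Quotient.eq]
  have h : (Homotopic.Quotient.mk γ).trans (c y) = (Homotopic.Quotient.mk δ).trans (c y) := by
    rw [Homotopic.Quotient.trans_eq_of_open_cover hU hcov c hc,
      Homotopic.Quotient.trans_eq_of_open_cover hU hcov c hc]
  have h' := congrArg (fun a => a.trans (c y).symm) h
  simpa [Homotopic.Quotient.trans_assoc] using h'

/-- Compatibility of the family `c` of path classes with the image under `f` of some path from `a` to
`b`. If the domain of `f` is simply connected, it is then compatible with the images of all of them. -/
def PathCompatible (c : ∀ x, Path.Homotopic.Quotient x x₀) (f : C(A, X)) (a b : A) : Prop :=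
  ∃ δ : Path a b, (Homotopic.Quotient.mk (δ.map f.continuous)).trans (c (f b)) = c (f a)

namespace PathCompatible

variable {c : ∀ x, Path.Homotopic.Quotient x x₀} {f : C(A, X)} {a b d : A}

lemma refl (a : A) : PathCompatible c f a a :=
  ⟨Path.refl a, by
    change (Homotopic.Quotient.mk (Path.refl (f a))).trans _ = _
    rw [Homotopic.Quotient.mk_refl, Homotopic.Quotient.refl_trans]⟩

lemma symm (h : PathCompatible c f a b) : PathCompatible c f b a := by
  obtain ⟨δ, h⟩ := h
  refine ⟨δ.symm, ?_⟩
  rw [← h, ← Path.map_symm, Homotopic.Quotient.mk_symm, ← Homotopic.Quotient.trans_assoc,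
    Homotopic.Quotient.symm_trans, Homotopic.Quotient.refl_trans]

lemma trans (h : PathCompatible c f a b) (h' : PathCompatible c f b d) :
    PathCompatible c f a d := by
  obtain ⟨δ, h⟩ := h
  obtain ⟨δ', h'⟩ := h'
  refine ⟨δ.trans δ', ?_⟩
  rw [Path.map_trans, Homotopic.Quotient.mk_trans, Homotopic.Quotient.trans_assoc, h', h]

/-- Compatible points of a simply connected space lead to the same class at every further point, along
the images of any paths. -/
lemma trans_eq_trans [SimplyConnectedSpace A] (h : PathCompatible c f a b) {p : A} (δ : Path p a)
    (δ' : Path p b) {x y z : X} (γ : Path x y) (γ' : Path x z) (hγ : ∀ t, γ t = f (δ t))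
    (hγ' : ∀ t, γ' t = f (δ' t)) :
    (Homotopic.Quotient.mk γ).trans (c y) = (Homotopic.Quotient.mk γ').trans (c z) := by
  obtain ⟨ε, h⟩ := h
  obtain rfl : x = f p := by simpa using hγ 0
  obtain rfl : y = f a := by simpa using hγ 1
  obtain rfl : z = f b := by simpa using hγ' 1
  obtain rfl : γ = δ.map f.continuous := Path.ext (funext hγ)
  obtain rfl : γ' = δ'.map f.continuous := Path.ext (funext hγ')
  have h1 : Homotopic.Quotient.mk (δ'.map f.continuous) =
      Homotopic.Quotient.mk ((δ.trans ε).map f.continuous) :=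
    Homotopic.Quotient.eq.2 ((SimplyConnectedSpace.paths_homotopic δ' (δ.trans ε)).map f)
  rw [h1, ← h, Path.map_trans, Homotopic.Quotient.mk_trans, Homotopic.Quotient.trans_assoc]

end PathCompatible

/-- Two concatenations of paths which are images of paths in a simply connected space agree up to
homotopy. -/
lemma Path.Homotopic.Quotient.trans_eq_trans_of_map [SimplyConnectedSpace A] (f : C(A, X))
    {p a q b : A} {x y z w : X} (δ₁ : Path p a) (δ₂ : Path a q) (δ₃ : Path p b) (δ₄ : Path b q)
    (γ₁ : Path x y) (γ₂ : Path y z) (γ₃ : Path x w) (γ₄ : Path w z)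
    (h₁ : ∀ t, γ₁ t = f (δ₁ t)) (h₂ : ∀ t, γ₂ t = f (δ₂ t)) (h₃ : ∀ t, γ₃ t = f (δ₃ t))
    (h₄ : ∀ t, γ₄ t = f (δ₄ t)) : (Homotopic.Quotient.mk γ₁).trans (Homotopic.Quotient.mk γ₂) =
      (Homotopic.Quotient.mk γ₃).trans (Homotopic.Quotient.mk γ₄) := by
  obtain rfl : x = f p := by simpa using h₁ 0
  obtain rfl : y = f a := by simpa using h₁ 1
  obtain rfl : z = f q := by simpa using h₂ 1
  obtain rfl : w = f b := by simpa using h₃ 1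
  obtain rfl : γ₁ = δ₁.map f.continuous := Path.ext (funext h₁)
  obtain rfl : γ₂ = δ₂.map f.continuous := Path.ext (funext h₂)
  obtain rfl : γ₃ = δ₃.map f.continuous := Path.ext (funext h₃)
  obtain rfl : γ₄ = δ₄.map f.continuous := Path.ext (funext h₄)
  rw [← Homotopic.Quotient.mk_trans, ← Homotopic.Quotient.mk_trans, ← Path.map_trans,
    ← Path.map_trans]
  exact Homotopic.Quotient.eq.2 ((SimplyConnectedSpace.paths_homotopic _ _).map f)

end PathClasses

namespace SimpleGraph

variable {V : Type u} {G : SimpleGraph V}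

/-! ### Straight paths in cells -/

namespace Cells

open Set.Icc

instance : ContractibleSpace I := (convex_Icc (0 : ℝ) 1).contractibleSpace ⟨0, by simp⟩

open Classical in
/-- The parameter of the end point `v` of an edge; `0` if `v` is not the target. -/
noncomputable def edgeCorner (v : V) (e : G.Dart) : I := if e.snd = v then 1 else 0

open Classical in
/-- The coordinates of the corner `v` of a square; `(0, 0)` if `v` is not a corner. -/
noncomputable def squareCorner (v : V) (q : FourCycle G) : I × I :=
  (if q.b = v ∨ q.c = v then 1 else 0, if q.c = v ∨ q.d = v then 1 else 0)

/-- The straight path in a closed cell from a point to the vertex `v` of the cell. -/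
noncomputable def pull (v : V) : Cells G → C(I, Cells G)
  | .inl x => .const I (.inl x)
  | .inr (.inl ⟨e, s⟩) => ⟨fun t => edgePoint e (convexComb s (edgeCorner v e) t),
      continuous_inr.comp (continuous_inl.comp
        (continuous_sigmaMk.comp (continuous_convexComb _ _)))⟩
  | .inr (.inr ⟨q, p⟩) => ⟨fun t => squarePoint q (convexComb p.1 (squareCorner v q).1 t)
        (convexComb p.2 (squareCorner v q).2 t),
      continuous_inr.comp (continuous_inr.comp (continuous_sigmaMk.comp
        ((continuous_convexComb _ _).prodMk (continuous_convexComb _ _))))⟩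

lemma pull_vertexPoint (v u : V) (t : I) : pull (G := G) v (vertexPoint u) t = vertexPoint u := rfl

lemma pull_edgePoint (v : V) (e : G.Dart) (s t : I) :
    pull v (edgePoint e s) t = edgePoint e (convexComb s (edgeCorner v e) t) := rfl

lemma pull_squarePoint (v : V) (q : FourCycle G) (x y t : I) :
    pull v (squarePoint q x y) t = squarePoint q (convexComb x (squareCorner v q).1 t)
      (convexComb y (squareCorner v q).2 t) := rfl

lemma continuous_pull (v : V) : Continuous (pull (G := G) v) := by
  refine continuous_sum_dom.2 ⟨?_, continuous_sum_dom.2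
    ⟨continuous_sigma fun e => ?_, continuous_sigma fun q => ?_⟩⟩
  · exact continuous_of_discreteTopology
  · refine ContinuousMap.continuous_of_continuous_uncurry _ ?_
    exact continuous_inr.comp (continuous_inl.comp (continuous_sigmaMk.comp
      (continuous_convexComb_prod.comp
        (continuous_fst.prodMk (continuous_const.prodMk continuous_snd)))))
  · refine ContinuousMap.continuous_of_continuous_uncurry _ ?_
    refine continuous_inr.comp (continuous_inr.comp (continuous_sigmaMk.comp (.prodMk ?_ ?_)))
    · exact continuous_convexComb_prod.comp
        ((continuous_fst.comp continuous_fst).prodMk (continuous_const.prodMk continuous_snd))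
    · exact continuous_convexComb_prod.comp
        ((continuous_snd.comp continuous_fst).prodMk (continuous_const.prodMk continuous_snd))

lemma pull_zero (v : V) (c : Cells G) : pull v c 0 = c := by
  rcases c with ⟨u, _⟩ | ⟨e, s⟩ | ⟨q, x, y⟩
  · rfl
  · change edgePoint e _ = edgePoint e _
    rw [convexComb_zero]
  · change squarePoint q _ _ = squarePoint q _ _
    rw [convexComb_zero, convexComb_zero]

lemma convexComb_zero_lt_one {s : I} (hs : s < 1) (t : I) : convexComb s 0 t < 1 :=
  (convexComb_symm 0 s t ▸ convexComb_le (a := 0) (b := 1) (unitInterval.nonneg' (t := s))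
    (unitInterval.symm t)).trans_lt hs

lemma zero_lt_convexComb_one {s : I} (hs : 0 < s) (t : I) : 0 < convexComb s 1 t :=
  hs.trans_le (le_convexComb unitInterval.le_one' t)

lemma symm_convexComb (x y t : I) : unitInterval.symm (convexComb x y t) =
    convexComb (unitInterval.symm x) (unitInterval.symm y) t := by
  ext
  simp only [unitInterval.coe_symm_eq, coe_convexComb]
  ring

section Corners
variable (q : FourCycle G)

lemma edgeCorner_fst (e : G.Dart) : edgeCorner e.fst e = 0 := if_neg e.adj.ne'
lemma edgeCorner_snd (e : G.Dart) : edgeCorner e.snd e = 1 := if_pos rfl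

lemma squareCorner_a : squareCorner q.a q = (0, 0) := by
  have h := q.sq
  simp [squareCorner, h.xa.ne', h.xb.ne', h.xu.symm]
lemma squareCorner_b : squareCorner q.b q = (1, 0) := by
  have h := q.sq
  simp [squareCorner, h.au.ne', h.ab.symm]
lemma squareCorner_c : squareCorner q.c q = (1, 1) := by simp [squareCorner]
lemma squareCorner_d : squareCorner q.d q = (0, 1) := by
  have h := q.sq
  simp [squareCorner, h.ab, h.bu.ne']

end Corners

lemma Near.pull {v : V} {c : Cells G} (h : Near v c) (t : I) : Near v (pull v c t) := by
  rcases c with ⟨u, _⟩ | ⟨e, s⟩ | ⟨q, x, y⟩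
  · exact h
  · change Near v (edgePoint e _)
    rcases h with ⟨rfl, h⟩ | ⟨rfl, h⟩
    · rw [edgeCorner_fst]
      exact Or.inl ⟨rfl, convexComb_zero_lt_one h t⟩
    · rw [edgeCorner_snd]
      exact Or.inr ⟨rfl, zero_lt_convexComb_one h t⟩
  · change Near v (squarePoint q _ _)
    rw [near_squarePoint]
    rcases h with ⟨rfl, h, h'⟩ | ⟨rfl, h, h'⟩ | ⟨rfl, h, h'⟩ | ⟨rfl, h, h'⟩
    · rw [squareCorner_a]
      exact Or.inl ⟨rfl, convexComb_zero_lt_one h t, convexComb_zero_lt_one h' t⟩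
    · rw [squareCorner_b]
      exact Or.inr (Or.inl ⟨rfl, zero_lt_convexComb_one h t, convexComb_zero_lt_one h' t⟩)
    · rw [squareCorner_c]
      exact Or.inr (Or.inr (Or.inl
        ⟨rfl, zero_lt_convexComb_one h t, zero_lt_convexComb_one h' t⟩))
    · rw [squareCorner_d]
      exact Or.inr (Or.inr (Or.inr
        ⟨rfl, convexComb_zero_lt_one h t, zero_lt_convexComb_one h' t⟩))

/-- Straight paths to a vertex are respected by the gluing. -/
lemma Glue.pull {c c' : Cells G} (h : Glue c c') {v : V} (hv : Near v c) (t : I) :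
    Glue (pull v c t) (pull v c' t) := by
  cases h with
  | edge_source e =>
    obtain rfl : e.fst = v := by simpa [near_edgePoint] using hv
    rw [pull_edgePoint, pull_vertexPoint, edgeCorner_fst, convexComb_eq]
    exact .edge_source e
  | edge_symm e s =>
    have : edgeCorner v e.symm = unitInterval.symm (edgeCorner v e) := by
      rcases hv with ⟨rfl, -⟩ | ⟨rfl, -⟩
      · rw [edgeCorner_fst, unitInterval.symm_zero]
        exact edgeCorner_snd e.symm
      · rw [edgeCorner_snd, unitInterval.symm_one]
        exact edgeCorner_fst e.symm
    rw [pull_edgePoint, pull_edgePoint, this, ← symm_convexComb]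
    exact .edge_symm e _
  | square_side q s =>
    have hv' : q.a = v ∨ q.b = v := by
      simp only [near_squarePoint, lt_irrefl, and_false, or_false] at hv
      tauto
    have : squareCorner v q = (edgeCorner v q.firstDart, 0) := by
      rcases hv' with rfl | rfl
      · rw [squareCorner_a, Prod.mk.injEq]
        exact ⟨(edgeCorner_fst q.firstDart).symm, rfl⟩
      · rw [squareCorner_b, Prod.mk.injEq]
        exact ⟨(edgeCorner_snd q.firstDart).symm, rfl⟩
    rw [pull_squarePoint, pull_edgePoint, this, convexComb_eq]
    exact .square_side q _
  | square_rotate q x y =>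
    have : squareCorner v q.rotate =
        ((squareCorner v q).2, unitInterval.symm (squareCorner v q).1) := by
      rcases hv with ⟨rfl, -⟩ | ⟨rfl, -⟩ | ⟨rfl, -⟩ | ⟨rfl, -⟩
      · rw [squareCorner_a, unitInterval.symm_zero]
        exact squareCorner_d q.rotate
      · rw [squareCorner_b, unitInterval.symm_one]
        exact squareCorner_a q.rotate
      · rw [squareCorner_c, unitInterval.symm_one]
        exact squareCorner_b q.rotate
      · rw [squareCorner_d, unitInterval.symm_zero]
        exact squareCorner_c q.rotate
    rw [pull_squarePoint, pull_squarePoint, this, ← symm_convexComb]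
    exact .square_rotate q _ _
  | square_reflect q x y =>
    have : squareCorner v q.reflect = ((squareCorner v q).2, (squareCorner v q).1) := by
      rcases hv with ⟨rfl, -⟩ | ⟨rfl, -⟩ | ⟨rfl, -⟩ | ⟨rfl, -⟩
      · rw [squareCorner_a]
        exact squareCorner_a q.reflect
      · rw [squareCorner_b]
        exact squareCorner_d q.reflect
      · rw [squareCorner_c]
        exact squareCorner_c q.reflect
      · rw [squareCorner_d]
        exact squareCorner_b q.reflect
    rw [pull_squarePoint, pull_squarePoint, this]
    exact .square_reflect q _ _

end Cells

namespace SquareCompletion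
open Cells _root_.Path

section CornerPoints
variable (q : FourCycle G)

lemma mk_square_bottom (s : I) : mk (squarePoint q s 0) = mk (edgePoint q.firstDart s) :=
  mk_eq (.square_side q s)

lemma mk_square_right (t : I) : mk (squarePoint q 1 t) = mk (edgePoint q.rotate.firstDart t) := by
  rw [mk_eq (.square_rotate q 1 t), unitInterval.symm_one, mk_square_bottom]

lemma mk_square_left (t : I) : mk (squarePoint q 0 t) = mk (edgePoint q.reflect.firstDart t) := by
  rw [mk_eq (.square_reflect q 0 t), mk_square_bottom]

lemma mk_square_top (s : I) :
    mk (squarePoint q s 1) = mk (edgePoint q.reflect.rotate.firstDart s) := by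
  rw [mk_eq (.square_reflect q s 1), mk_square_right]

end CornerPoints

lemma mk_pull_one {v : V} {c : Cells G} (h : Cells.Near v c) : mk (pull v c 1) = vertex v := by
  rcases c with ⟨u, _⟩ | ⟨e, s⟩ | ⟨q, x, y⟩
  · obtain rfl : u = v := h
    rfl
  · change mk (edgePoint e _) = _
    rw [Set.Icc.convexComb_one]
    rcases h with ⟨rfl, -⟩ | ⟨rfl, -⟩
    · rw [edgeCorner_fst, mk_edge_zero]
    · rw [edgeCorner_snd, mk_edge_one]
  · change mk (squarePoint q _ _) = _
    rw [Set.Icc.convexComb_one, Set.Icc.convexComb_one]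
    rcases h with ⟨rfl, -⟩ | ⟨rfl, -⟩ | ⟨rfl, -⟩ | ⟨rfl, -⟩
    · rw [squareCorner_a, mk_square_bottom, mk_edge_zero]
      rfl
    · rw [squareCorner_b, mk_square_bottom, mk_edge_one]
      rfl
    · rw [squareCorner_c, mk_square_right, mk_edge_one]
      rfl
    · rw [squareCorner_d, mk_square_left, mk_edge_one]
      rfl

/-! ### Contractibility of open stars -/

open Classical in
/-- The straight-line contraction of the open star of `v` to `v`; constant outside. -/
noncomputable def contract (v : V) (t : I) : G.SquareCompletion → G.SquareCompletion :=
  Quot.lift (fun c => if Cells.Near v c then mk (pull v c t) else vertex v) (by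
    intro c c' h
    by_cases hv : Cells.Near v c
    · rw [if_pos hv, if_pos ((h.near_iff v).1 hv), mk_eq (h.pull hv t)]
    · rw [if_neg hv, if_neg (mt (h.near_iff v).2 hv)])

lemma contract_mk {v : V} {c : Cells G} (h : Cells.Near v c) (t : I) :
    contract v t (mk c) = mk (pull v c t) := if_pos h

lemma contract_mem {v : V} {x : G.SquareCompletion} (h : x ∈ star G v) (t : I) :
    contract v t x ∈ star G v := by
  obtain ⟨c, rfl⟩ := mk_surjective x
  rw [contract_mk h]
  exact Cells.Near.pull h t

instance contractibleSpace_star (v : V) : ContractibleSpace (star G v) := by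
  rw [contractible_iff_id_nullhomotopic]
  have hcont : Continuous fun p : star G v × I =>
      (⟨contract v p.2 p.1, contract_mem p.1.2 p.2⟩ : star G v) := by
    refine (isQuotientMap_mk.restrictPreimage_isOpen (isOpen_star v)).continuous_lift_prod_left ?_
    refine Continuous.subtype_mk ?_ _
    have : Continuous fun p : (mk ⁻¹' star G v) × I => mk (pull v p.1.1 p.2) :=
      continuous_mk.comp (ContinuousMap.continuous_uncurry_of_continuous
        ⟨fun c : (mk ⁻¹' star G v) => pull v c.1,
          (continuous_pull v).comp continuous_subtype_val⟩)
    refine this.congr fun p => ?_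
    exact (contract_mk p.1.2 p.2).symm
  refine ⟨⟨vertex v, vertex_mem_star.2 rfl⟩, ⟨⟨⟨fun p => ⟨contract v p.1 p.2,
    contract_mem p.2.2 p.1⟩, hcont.comp continuous_swap⟩, ?_, ?_⟩⟩⟩
  · rintro ⟨x, hx⟩
    obtain ⟨c, rfl⟩ := mk_surjective x
    refine Subtype.ext ?_
    change contract v 0 (mk c) = mk c
    rw [contract_mk hx, pull_zero]
  · rintro ⟨x, hx⟩
    obtain ⟨c, rfl⟩ := mk_surjective x
    refine Subtype.ext ?_
    change contract v 1 (mk c) = vertex v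
    rw [contract_mk hx, mk_pull_one hx]

/-- Paths with common end points inside an open star are homotopic. -/
lemma mk_eq_mk_of_mem_star {v : V} {x y : G.SquareCompletion} {γ δ : _root_.Path x y}
    (hγ : ∀ t, γ t ∈ star G v) (hδ : ∀ t, δ t ∈ star G v) :
    Homotopic.Quotient.mk γ = Homotopic.Quotient.mk δ := by
  have hx : x ∈ star G v := by simpa using hγ 0
  have hy : y ∈ star G v := by simpa using hγ 1
  let lift : ∀ ε : _root_.Path x y, (∀ t, ε t ∈ star G v) →
      _root_.Path (⟨x, hx⟩ : star G v) ⟨y, hy⟩ := fun ε h =>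
    { toFun := fun t => ⟨ε t, h t⟩
      continuous_toFun := ε.continuous.subtype_mk h
      source' := Subtype.ext ε.source
      target' := Subtype.ext ε.target }
  exact Homotopic.Quotient.eq.2 ((SimplyConnectedSpace.paths_homotopic (lift γ hγ) (lift δ hδ)).map
    ⟨Subtype.val, continuous_subtype_val⟩)

lemma exists_path_star {v : V} {x y : G.SquareCompletion} (hx : x ∈ star G v)
    (hy : y ∈ star G v) : ∃ γ : _root_.Path x y, ∀ t, γ t ∈ star G v := by
  let γ := PathConnectedSpace.somePath (⟨x, hx⟩ : star G v) ⟨y, hy⟩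
  exact ⟨γ.map continuous_subtype_val, fun t => (γ t).2⟩

/-! ### Path classes on the square-completion -/

/-- The path along an oriented edge. -/
def edgePath {u v : V} (h : G.Adj u v) :
    _root_.Path (vertex u : G.SquareCompletion) (vertex v) where
  toFun t := mk (edgePoint ⟨(u, v), h⟩ t)
  continuous_toFun := continuous_mk.comp (continuous_inr.comp (continuous_inl.comp
    continuous_sigmaMk))
  source' := mk_edge_zero _
  target' := mk_edge_one _

lemma edgePath_symm {u v : V} (h : G.Adj u v) : edgePath h.symm = (edgePath h).symm :=
  Path.ext (funext fun t => ((mk_edge_symm ⟨(u, v), h⟩ _).trans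
    (by rw [unitInterval.symm_symm]; rfl)).symm)

/-- The map of the unit interval to the edge. -/
def edgeMap (e : G.Dart) : C(I, G.SquareCompletion) :=
  ⟨fun t => mk (edgePoint e t), (edgePath e.adj).continuous⟩

/-- The map of the unit square to the square. -/
def squareMap (q : FourCycle G) : C(I × I, G.SquareCompletion) :=
  ⟨fun p => mk (squarePoint q p.1 p.2), continuous_mk.comp (continuous_inr.comp
    (continuous_inr.comp (continuous_sigmaMk.comp (continuous_fst.prodMk continuous_snd))))⟩

/-- The straight path between two points of the unit interval. -/
noncomputable def linePath (a b : I) : _root_.Path a b :=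
  ⟨⟨Set.Icc.convexComb a b, Set.Icc.continuous_convexComb a b⟩, Set.Icc.convexComb_zero a b,
    Set.Icc.convexComb_one a b⟩

/-- The identity path of the unit interval. -/
def idPath : _root_.Path (0 : I) 1 := ⟨.id I, rfl, rfl⟩

/-- Horizontal sides of the unit square. -/
def horizontal (t : I) : _root_.Path ((0, t) : I × I) (1, t) := idPath.prod (_root_.Path.refl t)

/-- Vertical sides of the unit square. -/
def vertical (s : I) : _root_.Path ((s, 0) : I × I) (s, 1) := (_root_.Path.refl s).prod idPath

/-- The two ways around a square are homotopic. -/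
lemma edgePath_trans_edgePath {x a u b : V} (h : Sq G x a u b) :
    (Homotopic.Quotient.mk (edgePath h.xa)).trans (Homotopic.Quotient.mk (edgePath h.au)) =
      (Homotopic.Quotient.mk (edgePath h.xb)).trans (Homotopic.Quotient.mk (edgePath h.bu)) := by
  let q : FourCycle G := ⟨x, a, u, b, h.xa, h.au, h.bu.symm, h.xb.symm, h.xu, h.ab⟩
  exact Homotopic.Quotient.trans_eq_trans_of_map (squareMap q) (horizontal 0) (vertical 1)
    (vertical 0) (horizontal 1) _ _ _ _ (fun t => (mk_square_bottom q t).symm)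
    (fun t => (mk_square_right q t).symm) (fun t => (mk_square_left q t).symm)
    (fun t => (mk_square_top q t).symm)

/-- The path along `pull` from a point of a cell to a vertex of the cell. -/
noncomputable def pullPath {v : V} {c : Cells G} (h : Cells.Near v c) :
    _root_.Path (mk c) (vertex v) where
  toFun t := mk (pull v c t)
  continuous_toFun := continuous_mk.comp (pull v c).continuous
  source' := by rw [pull_zero]
  target' := mk_pull_one h

lemma pullPath_mem_star {v : V} {c : Cells G} (h : Cells.Near v c) (t : I) :
    pullPath h t ∈ star G v := Cells.Near.pull h t

section Extend

variable {x₀ : G.SquareCompletion} (cV : ∀ v : V, Homotopic.Quotient (vertex v) x₀)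

/-- The extension to all points of a family of path classes at the vertices, by paths inside open
stars. -/
noncomputable def extendClass (x : G.SquareCompletion) : Homotopic.Quotient x x₀ :=
  (Homotopic.Quotient.mk (exists_path_star (exists_mem_star x).choose_spec
    (vertex_mem_star.2 rfl)).choose).trans (cV (exists_mem_star x).choose)

/-- `extendClass cV x` is given by a path in some open star. -/
lemma exists_extendClass_eq (x : G.SquareCompletion) : ∃ (v : V) (γ : _root_.Path x (vertex v)),
    (∀ t, γ t ∈ star G v) ∧ (Homotopic.Quotient.mk γ).trans (cV v) = extendClass cV x :=
  ⟨_, _, (exists_path_star (exists_mem_star x).choose_spec (vertex_mem_star.2 rfl)).choose_spec,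
    rfl⟩

lemma extendClass_vertex (v : V) : extendClass cV (vertex v) = cV v := by
  obtain ⟨w, γ, hγ, h⟩ := exists_extendClass_eq cV (vertex v)
  obtain rfl : v = w := vertex_mem_star.1 (by simpa using hγ 0)
  rw [← h, mk_eq_mk_of_mem_star (δ := _root_.Path.refl _) hγ fun _ => vertex_mem_star.2 rfl,
    Homotopic.Quotient.mk_refl, Homotopic.Quotient.refl_trans]

variable (hV : ∀ {u v : V} (h : G.Adj u v),
  (Homotopic.Quotient.mk (edgePath h)).trans (cV v) = cV u)
include hV

lemma pathCompatible_of_edge {A : Type*} [TopologicalSpace A] {f : C(A, G.SquareCompletion)}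
    {a b : A} (δ : _root_.Path a b) (e : G.Dart) (h : ∀ t, f (δ t) = mk (edgePoint e t)) :
    PathCompatible (extendClass cV) f a b := by
  have h0 : f a = vertex e.fst := by rw [← mk_edge_zero, ← h, δ.source]
  have h1 : f b = vertex e.snd := by rw [← mk_edge_one, ← h, δ.target]
  refine ⟨δ, ?_⟩
  have : δ.map f.continuous = (edgePath e.adj).cast h0 h1 := _root_.Path.ext (funext h)
  rw [this, Homotopic.Quotient.mk_cast_trans_iff, extendClass_vertex, extendClass_vertex, hV]

/-- Inside a cell, the classes obtained from different vertices of the cell agree. -/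
lemma pullPath_trans {v w : V} {c : Cells G} (hv : Cells.Near v c) (hw : Cells.Near w c) :
    (Homotopic.Quotient.mk (pullPath hv)).trans (cV v) =
      (Homotopic.Quotient.mk (pullPath hw)).trans (cV w) := by
  rw [← extendClass_vertex cV v, ← extendClass_vertex cV w]
  have corner : ∀ (p : Prop) (_ : Decidable p), (if p then (1 : I) else 0) = 0 ∨
      (if p then (1 : I) else 0) = 1 := fun p _ => by split_ifs <;> simp
  rcases c with ⟨u, _⟩ | ⟨e, s⟩ | ⟨q, x, y⟩
  · obtain rfl : u = v := hv
    obtain rfl : u = w := hw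
    rfl
  · -- All end points of the edge are compatible.
    have h0 : ∀ a : I, a = 0 ∨ a = 1 → PathCompatible (extendClass cV) (edgeMap e) 0 a := by
      rintro a (rfl | rfl)
      · exact .refl 0
      · exact pathCompatible_of_edge cV hV idPath e fun t => rfl
    have h := (h0 (edgeCorner v e) (corner _ _)).symm.trans (h0 (edgeCorner w e) (corner _ _))
    exact h.trans_eq_trans (linePath s _) (linePath s _) _ _ (fun t => rfl) fun t => rfl
  · -- All corners of the square are compatible, by the bottom, left and right sides.
    have h0 : ∀ a b : I, a = 0 ∨ a = 1 → b = 0 ∨ b = 1 →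
        PathCompatible (extendClass cV) (squareMap q) (0, 0) (a, b) := by
      have h1 : PathCompatible (extendClass cV) (squareMap q) (0, 0) (1, 0) :=
        pathCompatible_of_edge cV hV (horizontal 0) q.firstDart (mk_square_bottom q)
      rintro a b (rfl | rfl) (rfl | rfl)
      · exact .refl _
      · exact pathCompatible_of_edge cV hV (vertical 0) q.reflect.firstDart (mk_square_left q)
      · exact h1
      · exact h1.trans
          (pathCompatible_of_edge cV hV (vertical 1) q.rotate.firstDart (mk_square_right q))
    have h := (h0 (squareCorner v q).1 (squareCorner v q).2 (corner _ _) (corner _ _)).symm.trans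
      (h0 (squareCorner w q).1 (squareCorner w q).2 (corner _ _) (corner _ _))
    exact h.trans_eq_trans ((linePath x _).prod (linePath y _))
      ((linePath x _).prod (linePath y _)) _ _ (fun t => rfl) fun t => rfl

/-- Every path inside an open star to its centre can be used to compute `extendClass`. -/
lemma trans_eq_extendClass {v : V} {x : G.SquareCompletion} (γ : _root_.Path x (vertex v))
    (hγ : ∀ t, γ t ∈ star G v) :
    (Homotopic.Quotient.mk γ).trans (cV v) = extendClass cV x := by
  obtain ⟨w, δ, hδ, h⟩ := exists_extendClass_eq cV x
  have hv : x ∈ star G v := by simpa using hγ 0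
  have hw : x ∈ star G w := by simpa using hδ 0
  obtain ⟨c, rfl⟩ := mk_surjective x
  rw [← h, mk_eq_mk_of_mem_star hγ (pullPath_mem_star hv),
    mk_eq_mk_of_mem_star hδ (pullPath_mem_star hw), pullPath_trans cV hV hv hw]

/-- The square-completion is simply connected if there is a family of path classes from the
vertices to a base point which is compatible with the edges. -/
theorem simplyConnectedSpace_of_classes : SimplyConnectedSpace G.SquareCompletion := by
  refine .of_open_cover (U := star G) isOpen_star exists_mem_star (extendClass cV)
    fun v x y γ hγ => ?_
  have hy : y ∈ star G v := by simpa using hγ 1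
  obtain ⟨δ, hδ⟩ := exists_path_star hy (vertex_mem_star.2 rfl)
  rw [← trans_eq_extendClass cV hV δ hδ, ← trans_eq_extendClass cV hV (γ.trans δ),
    Homotopic.Quotient.mk_trans, Homotopic.Quotient.trans_assoc]
  intro t
  rw [_root_.Path.trans_apply]
  split_ifs
  exacts [hγ _, hδ _]

end Extend

/-! ### Geodesics and simple connectivity -/

/-- The path class of a walk. -/
noncomputable def walkClass : ∀ {u v : V}, G.Walk u v →
    Homotopic.Quotient (vertex u : G.SquareCompletion) (vertex v)
  | _, _, .nil => .refl _
  | _, _, .cons h p => (Homotopic.Quotient.mk (edgePath h)).trans (walkClass p)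

lemma walkClass_cons {u v w : V} (h : G.Adj u v) (p : G.Walk v w) : walkClass (.cons h p) =
    (Homotopic.Quotient.mk (edgePath h)).trans (walkClass p) := rfl

/-- By the quadrangle condition, geodesics with common end points are homotopic. -/
lemma walkClass_eq_of_geodesic (hG : G.Connected) (hq : QuadrangleCondition G) (v : V) :
    ∀ (n : ℕ) (z : V) (p q : G.Walk z v), p.length = n → q.length = n → G.dist z v = n →
      walkClass p = walkClass q := by
  intro n
  induction n with
  | zero =>
    intro z p q hp hq _
    cases p with
    | nil =>
      cases q with
      | nil => rfl
      | cons h q => simp at hq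
    | cons h p => simp at hp
  | succ n ih =>
    intro z p q hp hq' hz
    cases p with
    | nil => simp at hp
    | @cons _ x _ hx p =>
    cases q with
    | nil => simp at hq'
    | @cons _ y _ hy q =>
    simp only [Walk.length_cons, Nat.add_right_cancel_iff] at hp hq'
    have dist_eq : ∀ {x : V} (_ : G.Adj z x) (p : G.Walk x v), p.length = n →
        G.dist x v = n := by
      intro x hx p hp
      have h1 := dist_le p
      have h2 := hG.dist_triangle (u := z) (v := x) (w := v)
      have h3 := dist_eq_one_iff_adj.2 hx
      omega
    have hxd := dist_eq hx p hp
    have hyd := dist_eq hy q hq'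
    rw [walkClass_cons, walkClass_cons]
    by_cases hxy : x = y
    · subst hxy
      rw [ih x p q hp hq' hxd]
    · obtain ⟨u, hxu, hyu, hu⟩ := hq v z x y hx hy hxy (by omega) (by omega)
      obtain ⟨r, hr⟩ := hG.exists_walk_length_eq_dist u v
      have hzu : z ≠ u := by rintro rfl; omega
      rw [ih x p (.cons hxu r) hp (by rw [Walk.length_cons]; omega) hxd,
        ih y q (.cons hyu r) hq' (by rw [Walk.length_cons]; omega) hyd, walkClass_cons,
        walkClass_cons, ← Homotopic.Quotient.trans_assoc, ← Homotopic.Quotient.trans_assoc,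
        edgePath_trans_edgePath (h := ⟨hx, hxu, hy, hyu, hzu, hxy⟩)]

end SquareCompletion

open SquareCompletion in
/-- The square-completion of a connected graph with the quadrangle condition in which adjacent
vertices have different distances to any third vertex is simply connected: the classes of the
geodesics to a base vertex are compatible with all edges. -/
theorem QuadrangleCondition.simplyConnectedSpace (hq : QuadrangleCondition G)
    (hp : DistParity G) (hG : G.Connected) : SimplyConnectedSpace G.SquareCompletion := by
  obtain ⟨v⟩ := hG.nonempty
  choose geo hgeo using fun z => hG.exists_walk_length_eq_dist z v
  have down : ∀ {x y : V} (h : G.Adj x y), G.dist x v = G.dist y v + 1 →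
      (Path.Homotopic.Quotient.mk (edgePath h)).trans (walkClass (geo y)) =
        walkClass (geo x) := by
    intro x y h hd
    rw [← walkClass_cons]
    exact walkClass_eq_of_geodesic hG hq v _ x _ _ (by rw [Walk.length_cons, hgeo, hd]) (hgeo x) rfl
  refine simplyConnectedSpace_of_classes (fun z => walkClass (geo z)) fun {x y} h => ?_
  rcases hp.eq_or_eq hG h v with hd | hd
  · exact down h hd
  · rw [← down h.symm hd, edgePath_symm h, Path.Homotopic.Quotient.mk_symm,
      ← Path.Homotopic.Quotient.trans_assoc, Path.Homotopic.Quotient.trans_symm,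
      Path.Homotopic.Quotient.refl_trans]

end SimpleGraph

theorem mainTheorem1 {V : Type*} (G : SimpleGraph V) :
    G.IsMedian ↔
      SimplyConnectedSpace G.SquareCompletion ∧
      (∀ v a b : V, G.Adj v a → G.Adj v b →
        ∀ w w' : V, G.SpanFourCycleWith v a b w → G.SpanFourCycleWith v a b w' → w = w') ∧
      (∀ v a b c : V, G.Adj v a → G.Adj v b → G.Adj v c →
        G.SpanFourCycle v a b → G.SpanFourCycle v b c → G.SpanFourCycle v a c →
        G.SpanCube v a b c) := by
  constructor
  · intro h
    exact ⟨h.quadrangleCondition.simplyConnectedSpace h.distParity h.1, h.uniqueSquares,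
      h.cubeCondition⟩
  · rintro ⟨hs, hu, hc⟩
    exact SimpleGraph.SquareCompletion.localSystemsTrivial.isMedian hu hc
      SimpleGraph.SquareCompletion.connected_of_connectedSpace
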